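/- **Setting.** Let $\Gamma\subset\mathrm{SL}(2,\mathbb R)$ be a discrete subgroup with $-1\in\Gamma$ and finite covolume, such that the hyperbolic surface $\mathcal Y=\Gamma\backslash\mathbb H$ has $K\ge 1$ cusps. Put $\mathcal X=\Gamma\backslash\mathrm{SL}(2,\mathbb R)$ (the unit tangent bundle of $\mathcal Y$), let $\pi:\mathcal X\to\mathcal Y$, $\pi(\Gamma g)=\Gamma g i$, be the projection, and let $\mu$ be the Liouville measure on $\mathcal X$, i.e. the measure induced by Haar measure, normalised so that $\mu(\mathcal X)=1$. For $x\in\mathcal X$ define $$\varphi_t(x)=x\begin{pmatrix}e^{t/2}&0\\0&e^{-t/2}\end{pmatrix},\qquad h^+_s(x)=x\begin{pmatrix}1&0\\-s&1\end{pmatrix},\qquad h^-_s(x)=x\begin{pmatrix}1&s\\0&1\end{pmatrix}$$ (geodesic, unstable and stable horocycle flow). A Borel probability measure $\lambda$ on $\mathcal X$ is *admissible* if $\lim_{t\to\infty}\lambda(\varphi_t\mathcal E)=\mu(\mathcal E)$ for every Borel set $\mathcal E\subset\mathcal X$ with $\mu(\partial\mathcal E)=0$. **Sections.** For $\kappa=1,\dots,K$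 let $g_\kappa\in\mathrm{SL}(2,\mathbb R)$ map the $\kappa$th cusp to a cusp at infinity of width one, so that $g_\kappa^{-1}\begin{pmatrix}1&s\\0&1\end{pmatrix}g_\kappa\in\Gamma$ if and only if $s\in\mathbb Z$. Put $x_\kappa=\Gamma g_\kappa^{-1}$; then $\mathcal C_\kappa=\{h^-_s(x_\kappa):s\in\mathbb R\}$ is the closed stable horocycle of length one around the cusp. For $\sigma\in\mathbb R^K$ let $$\Sigma^K(\sigma)=\{(s,t,\kappa): s\in[0,1),\ t\ge\sigma_\kappa,\ 1\le \kappa\le K\},\qquad \iota(s,t,\kappa)=\varphi_t\circ h_s^-(x_\kappa),$$ and let $\mathcal H(\sigma)=\iota(\Sigma^K(\sigma))=\bigcup_\kappa\bigcup_{t\ge\sigma_\kappa}\varphi_t(\mathcal C_\kappa)$. The map $\iota$ is injective on $\Sigma^K(\sigma)$. **Heights.** The relative height of $x=\iota(s,t,\kappa)\in\mathcal H(\sigma)$ is $\widetilde\tau(x,\sigma)=t-\sigma_\kappa$. The relative height $\widetilde\tau(y,\sigma)$ of $y\in\pi\mathcal H(\sigma)$ is the relative height of the point of $\pi^{-1}(y)\cap\mathcal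 H(\sigma)$; this point is unique if all $\sigma_\kappa$ are sufficiently large, and in general the largest relative height is taken. Points outside $\mathcal H(\sigma)$, respectively $\pi\mathcal H(\sigma)$, have height $-\infty$, and a supremum over the empty set is $-\infty$. **Hitting times and density.** Let $\xi_1<\xi_2<\dots$, $\xi_j=\xi_j(x_0,\sigma)$, be the times $r>0$ at which $h_r^+(x_0)\in\mathcal H(\sigma)$. For $(s,t,\kappa)\in\Sigma^K(\sigma)$ let $\eta_{1}(s,t,\kappa)$, respectively $\eta_{-1}(s,t,\kappa)$, be the infimum of the $r>0$ with $h^+_{r}(\iota(s,t,\kappa))\in\mathcal H(\sigma)$, respectively $h^+_{-r}(\iota(s,t,\kappa))\in\mathcal H(\sigma)$ ($\infty$ if there is none). Put $$\overline\eta_1(\sigma)=\sum_{\kappa=1}^K\int_0^1\int_{\sigma_\kappa}^\infty\eta_1(s,t,\kappa)\,e^{-t}\,dt\,ds,\qquad \Psi_\sigma(r)=\frac1{\overline\eta_1(\sigma)}\sum_{\kappa=1}^K\int_0^1\int_{\sigma_\kappa}^\infty\mathbf 1\big(r<\eta_{-1}(s,t,\kappa)\big)\,e^{-t}\,dt\,ds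 .$$ **Theorem.** Let $\lambda$ be admissible and $\sigma\in\mathbb R^K$. Then $\rho_\sigma(s)=e^{-s}\,\Psi_\sigma(e^{-s})$ is an $\mathrm L^1$ probability density on $\mathbb R$, and for every $H\in\mathbb R$ $$\lim_{T\to\infty}\lambda\Big\{x_0\in\mathcal X:\ \sup_{0\le s\le T}\widetilde\tau(\pi\circ h^+_s(x_0),\sigma)>H+\log T\Big\}=\int_H^\infty\rho_\sigma(s)\,ds$$ and $$\lim_{T\to\infty}\lambda\Big\{x_0\in\mathcal X:\ \sup_{0\le\xi_j\le T}\widetilde\tau(h^+_{\xi_j}(x_0),\sigma)>H+\log T\Big\}=\int_H^\infty\rho_\sigma(s)\,ds .$$ -/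

import Mathlib

open MeasureTheory Filter Topology
open scoped ENNReal MatrixGroups

noncomputable section

namespace HorocycleExtremes

/-! ### The group `SL(2, ℝ)` and its Haar measure -/

instance instMeasurableSpaceSL : MeasurableSpace SL(2, ℝ) := borel _

instance instBorelSpaceSL : BorelSpace SL(2, ℝ) := ⟨rfl⟩

instance instLocallyCompactSpaceSL : LocallyCompactSpace SL(2, ℝ) :=
  haveI : LocallyCompactSpace (Matrix (Fin 2) (Fin 2) ℝ) :=
    inferInstanceAs (LocallyCompactSpace (Fin 2 → Fin 2 → ℝ))
  (Matrix.SpecialLinearGroup.isClosedEmbedding_val (n := Fin 2) (R := ℝ)).locallyCompactSpace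

/-- The diagonal matrix `diag (e^{t/2}, e^{-t/2})`. -/
def geodesicMatrix (t : ℝ) : SL(2, ℝ) :=
  ⟨!![Real.exp (t / 2), 0; 0, Real.exp (-(t / 2))], by
    rw [Matrix.det_fin_two_of, ← Real.exp_add]; simp⟩

/-- The lower triangular unipotent matrix `(1, 0; -s, 1)`. -/
def unstableMatrix (s : ℝ) : SL(2, ℝ) :=
  ⟨!![1, 0; -s, 1], by rw [Matrix.det_fin_two_of]; simp⟩

/-- The upper triangular unipotent matrix `(1, s; 0, 1)`. -/
def stableMatrix (s : ℝ) : SL(2, ℝ) :=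
  ⟨!![1, s; 0, 1], by rw [Matrix.det_fin_two_of]; simp⟩

/-! ### The unit tangent bundle, the surface and the flows -/

/-- The unit tangent bundle `𝒳 = Γ \ SL(2, ℝ)`; its points are the cosets `Γ g`. -/
def UnitTangent (Γ : Subgroup SL(2, ℝ)) : Type :=
  MulAction.orbitRel.Quotient Γ SL(2, ℝ)

/-- The surface `𝒴 = Γ \ ℍ`. -/
def Surface (Γ : Subgroup SL(2, ℝ)) : Type :=
  MulAction.orbitRel.Quotient Γ UpperHalfPlane

variable {Γ : Subgroup SL(2, ℝ)}

instance instTopologicalSpaceUnitTangent : TopologicalSpace (UnitTangent Γ) :=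
  inferInstanceAs (TopologicalSpace (MulAction.orbitRel.Quotient Γ SL(2, ℝ)))

instance instMeasurableSpaceUnitTangent : MeasurableSpace (UnitTangent Γ) := borel _

instance instBorelSpaceUnitTangent : BorelSpace (UnitTangent Γ) := ⟨rfl⟩

/-- The coset `Γ g`. -/
def UnitTangent.mk (Γ : Subgroup SL(2, ℝ)) (g : SL(2, ℝ)) : UnitTangent Γ :=
  Quotient.mk (MulAction.orbitRel Γ SL(2, ℝ)) g

/-- Right multiplication `Γ g ↦ Γ g h`. -/
def rightMul (h : SL(2, ℝ)) : UnitTangent Γ → UnitTangent Γ :=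
  Quotient.map (fun g : SL(2, ℝ) => g * h) (by
    rintro a b ⟨γ, rfl⟩
    exact ⟨γ, by simp [Subgroup.smul_def, mul_assoc]⟩)

/-- The geodesic flow `φ_t`. -/
def geodesicFlow (t : ℝ) : UnitTangent Γ → UnitTangent Γ := rightMul (geodesicMatrix t)

/-- The unstable horocycle flow `h_s^+`. -/
def unstableFlow (s : ℝ) : UnitTangent Γ → UnitTangent Γ := rightMul (unstableMatrix s)

/-- The stable horocycle flow `h_s^-`. -/
def stableFlow (s : ℝ) : UnitTangent Γ → UnitTangent Γ := rightMul (stableMatrix s)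

/-- The natural projection `π : 𝒳 → 𝒴`, `Γ g ↦ Γ (g • i)`. -/
def proj : UnitTangent Γ → Surface Γ :=
  Quotient.map (fun g : SL(2, ℝ) => g • UpperHalfPlane.I) (by
    rintro a b ⟨γ, rfl⟩
    exact ⟨γ, by simp [Subgroup.smul_def, mul_smul]⟩)

/-- The Liouville measure on `𝒳`: Haar measure on a fundamental domain `F` of `Γ` in `SL(2, ℝ)`,
projected to `𝒳` and normalised to total mass one. -/
def liouville (Γ : Subgroup SL(2, ℝ)) (F : Set SL(2, ℝ)) : Measure (UnitTangent Γ) :=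
  (Measure.haar F)⁻¹ • (Measure.haar.restrict F).map (UnitTangent.mk Γ)

/-- A Borel measure `ν` on `𝒳` is admissible if `ν (φ_t E) → μ E` as `t → ∞` for every Borel set
`E` whose boundary is a `μ`-null set. -/
def IsAdmissible (μ ν : Measure (UnitTangent Γ)) : Prop :=
  ∀ E : Set (UnitTangent Γ), MeasurableSet E → μ (frontier E) = 0 →
    Tendsto (fun t : ℝ => ν (geodesicFlow t '' E)) atTop (𝓝 (μ E))

/-! ### Cusps and sections -/

/-- The boundary point `g⁻¹ • ∞`, which `g` maps to `∞`. -/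
def cuspOf (g : SL(2, ℝ)) : OnePoint ℝ :=
  Matrix.SpecialLinearGroup.toGL g⁻¹ • (OnePoint.infty : OnePoint ℝ)

/-- `g 0, …, g (K - 1)` are scaling matrices for the cusps of `Γ`: the points `(g κ)⁻¹ • ∞`
represent every `Γ`-equivalence class of cusps exactly once, and `g κ` maps its cusp to a cusp of
width one at infinity. -/
structure IsCuspScaling (Γ : Subgroup SL(2, ℝ)) {K : ℕ} (g : Fin K → SL(2, ℝ)) : Prop where
  width_one : ∀ (κ : Fin K) (s : ℝ),
    (g κ)⁻¹ * stableMatrix s * g κ ∈ Γ ↔ ∃ m : ℤ, s = m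
  inequivalent : ∀ κ ℓ : Fin K, κ ≠ ℓ → ∀ γ ∈ Γ,
    Matrix.SpecialLinearGroup.toGL γ • cuspOf (g κ) ≠ cuspOf (g ℓ)
  complete : ∀ c : OnePoint ℝ, IsCusp c (Γ.map Matrix.SpecialLinearGroup.toGL) →
    ∃ κ : Fin K, ∃ γ ∈ Γ, Matrix.SpecialLinearGroup.toGL γ • cuspOf (g κ) = c

variable {K : ℕ}

/-- The base point `x_κ = Γ (g κ)⁻¹` on the closed stable horocycle of length one around the
cusp `κ`. -/
def basePoint (Γ : Subgroup SL(2, ℝ)) (g : Fin K → SL(2, ℝ)) (κ : Fin K) : UnitTangent Γ :=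
  UnitTangent.mk Γ (g κ)⁻¹

/-- The closed stable horocycle `𝒞_κ` of length one. -/
def closedHorocycle (Γ : Subgroup SL(2, ℝ)) (g : Fin K → SL(2, ℝ)) (κ : Fin K) :
    Set (UnitTangent Γ) :=
  Set.range fun s : ℝ => stableFlow s (basePoint Γ g κ)

/-- The section `ℋ_κ(R) = {φ_t(𝒞_κ) : t ≥ R}`. -/
def cuspSection (Γ : Subgroup SL(2, ℝ)) (g : Fin K → SL(2, ℝ)) (κ : Fin K) (R : ℝ) :
    Set (UnitTangent Γ) :=
  ⋃ t ∈ Set.Ici R, geodesicFlow t '' closedHorocycle Γ g κ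

/-- The multi-cusp section `ℋ(σ, R) = ⋃_κ ℋ_κ(σ_κ + R)`. -/
def multiSection (Γ : Subgroup SL(2, ℝ)) (g : Fin K → SL(2, ℝ)) (σ : Fin K → ℝ) (R : ℝ) :
    Set (UnitTangent Γ) :=
  ⋃ κ, cuspSection Γ g κ (σ κ + R)

/-- The parameter space `Σ^K(σ)` of triples `(s, t, κ)` with `s ∈ [0, 1)` and `t ≥ σ_κ`. -/
def sectionParams (σ : Fin K → ℝ) : Set (ℝ × ℝ × Fin K) :=
  {w | w.1 ∈ Set.Ico 0 1 ∧ σ w.2.2 ≤ w.2.1}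

/-- The parametrisation `ι(s, t, κ) = φ_t (h_s^- x_κ)`; it maps `Σ^K(σ)` onto `ℋ(σ, 0)`. -/
def sectionMap (Γ : Subgroup SL(2, ℝ)) (g : Fin K → SL(2, ℝ)) (w : ℝ × ℝ × Fin K) :
    UnitTangent Γ :=
  geodesicFlow w.2.1 (stableFlow w.1 (basePoint Γ g w.2.2))

/-! ### Heights -/

/-- The relative height `t - σ_κ` of the point `x = ι(s, t, κ)` of the section `ℋ(σ, 0)`, and
`⊥` off the section. -/
def relHeight (g : Fin K → SL(2, ℝ)) (σ : Fin K → ℝ) (x : UnitTangent Γ) : EReal :=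
  ⨆ w ∈ {w | w ∈ sectionParams σ ∧ sectionMap Γ g w = x}, ((w.2.1 - σ w.2.2 : ℝ) : EReal)

/-- The relative height of a point `y` of the surface: the height of its lift to the section
`ℋ(σ, 0)`, the highest one if there are several (there is at most one when all `σ_κ` are
large), and `⊥` if `y` is not in the projected section. -/
def relHeightSurface (g : Fin K → SL(2, ℝ)) (σ : Fin K → ℝ) (y : Surface Γ) : EReal :=
  ⨆ x ∈ {x | x ∈ multiSection Γ g σ 0 ∧ proj x = y}, relHeight g σ x

/-! ### Hitting times, return times and the limit density -/

/-- The set `{ξ_1, ξ_2, …}` of hitting times of the section `ℋ(σ, R)` along the unstable horocycle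
orbit of `x`. -/
def hittingTimes (g : Fin K → SL(2, ℝ)) (σ : Fin K → ℝ) (R : ℝ) (x : UnitTangent Γ) : Set ℝ :=
  {r | 0 < r ∧ unstableFlow r x ∈ multiSection Γ g σ R}

/-- The first return time `η_1(s, t, κ, σ)` to `ℋ(σ, 0)`, starting at `ι(s, t, κ)`
(`∞` if there is no return). -/
def returnTime (Γ : Subgroup SL(2, ℝ)) (g : Fin K → SL(2, ℝ)) (σ : Fin K → ℝ)
    (w : ℝ × ℝ × Fin K) : ℝ≥0∞ :=
  ⨅ r ∈ hittingTimes g σ 0 (sectionMap Γ g w), ENNReal.ofReal r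

/-- The first backward return time `η_{-1}(s, t, κ, σ)` to `ℋ(σ, 0)`, starting at `ι(s, t, κ)`
(`∞` if there is no return). -/
def backwardReturnTime (Γ : Subgroup SL(2, ℝ)) (g : Fin K → SL(2, ℝ)) (σ : Fin K → ℝ)
    (w : ℝ × ℝ × Fin K) : ℝ≥0∞ :=
  ⨅ r ∈ {r : ℝ | 0 < r ∧ unstableFlow (-r) (sectionMap Γ g w) ∈ multiSection Γ g σ 0},
    ENNReal.ofReal r

/-- The integral of `f` over `Σ^K(σ)` against `ν_σ(ds, dt, {κ}) = e^{-t} dt ds`. -/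
def sectionIntegral (σ : Fin K → ℝ) (f : ℝ × ℝ × Fin K → ℝ≥0∞) : ℝ≥0∞ :=
  ∑ κ, ∫⁻ s in Set.Ico (0 : ℝ) 1, ∫⁻ t in Set.Ici (σ κ),
    f (s, t, κ) * ENNReal.ofReal (Real.exp (-t))

/-- The mean return time `η̄_1(σ)`. -/
def meanReturnTime (Γ : Subgroup SL(2, ℝ)) (g : Fin K → SL(2, ℝ)) (σ : Fin K → ℝ) : ℝ≥0∞ :=
  sectionIntegral σ (returnTime Γ g σ)

open Classical in
/-- The joint density `Ψ_σ(r, w, κ) = 1(r < η_{-1}(w, κ, σ)) / η̄_1(σ)` of hitting time and impact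
parameter. -/
def jointDensity (Γ : Subgroup SL(2, ℝ)) (g : Fin K → SL(2, ℝ)) (σ : Fin K → ℝ) (r : ℝ)
    (w : ℝ × ℝ × Fin K) : ℝ≥0∞ :=
  (meanReturnTime Γ g σ)⁻¹ *
    (if ENNReal.ofReal r < backwardReturnTime Γ g σ w then 1 else 0)

/-- The hitting time density `Ψ_σ(r)`. -/
def hittingDensity (Γ : Subgroup SL(2, ℝ)) (g : Fin K → SL(2, ℝ)) (σ : Fin K → ℝ) (r : ℝ) : ℝ :=
  (sectionIntegral σ (jointDensity Γ g σ r)).toReal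

/-- The limit density `ρ_σ(s) = e^{-s} Ψ_σ(e^{-s})`. -/
def extremeDensity (Γ : Subgroup SL(2, ℝ)) (g : Fin K → SL(2, ℝ)) (σ : Fin K → ℝ) (s : ℝ) : ℝ :=
  Real.exp (-s) * hittingDensity Γ g σ (Real.exp (-s))

end HorocycleExtremes

end

noncomputable section

namespace HorocycleExtremes

/-! ### Topology and Haar measure of `SL(2, ℝ)` -/

/-! Everything is read off from the plane vectors `row (g κ * γ * x)` with `γ ∈ Γ`, the bottom rows
attached to a lift `x` of a point of `𝒳`. The point lies in the section at cusp `κ` exactly when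
some such `v` has `v.1 = 0` and `0 < v.2 ≤ e^{-σ_κ/2}`; its height parameter is then `t = -2 log
v.2`. The flow `h^+_r` sends `v` to `(v.1 - r v.2, v.2)`, so `v` produces a hit at time `v.1 / v.2`.
The geodesic flow `φ_t` multiplies the two coordinates by `e^{t/2}` and `e^{-t/2}`.

Put `L = H + log T`. When `L ≥ 0`, the section event asks for a vector with `0 < v.1 ≤ T v.2` and `0
< v.2 < e^{-(σ_κ+L)/2}`. Rescaling by `φ_L` removes `T`: the event is exactly the `φ_L`-image of the
fixed set `hitQuot Γ g (extremeRegion σ H)` (`sectionExtreme_eq`). Admissibility gives convergence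
to the Liouville measure of this set once its frontier is null. That holds because the regions are
bounded and convex and the vector orbits are locally finite (`finite_row_orbit_of_isCompact`,
`frontier_hitSet_subset`, `liouville_frontier_hitQuot`).

On the surface, height above `h ≥ 0` means `v.1 ^ 2 + v.2 ^ 2 < e^{-(σ_κ+h)}` for some orbit vector.
The surface event contains the section event and is contained in the `φ_L`-image of a hit set for a
slightly thicker region, with thickness of order `e^{-L}` (`surfaceExtreme_subset`). Letting the
thickness tend to zero gives the same limit (`tendsto_surfaceExtreme`).

To compute the limiting measure, Haar measure is written as a constant times `e^{-t} ds dt dr` in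
flow boxes over the section (`exists_haar_flowBox`). Almost every orbit hits the section
(`ae_mem_hitSet_quadrantStrip`), so the points sorted by first hit form a fundamental domain. In it,
the fibre over a section point is `0 < r ≤ η_{-1}` (`isFundamentalDomain_hitDomain`,
`haar_iUnion_hitDomain`). The event is, up to a null set, that the first hitting time is at most
`e^{-H}`; its measure is thus proportional to the integral of `min(e^{-H}, η_{-1})`, which is the
integral of `Ψ_σ` over `(0, e^{-H})` and becomes the tail of `ρ_σ` under `r = e^{-s}`. Repeating the
construction with time reversed shows that `η_1` and `η_{-1}` have the same mean, which fixes the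
normalisation (`haar_eq_sectionIntegral`). -/

instance instSecondCountableTopologySL : SecondCountableTopology SL(2, ℝ) :=
  haveI : SecondCountableTopology (Matrix (Fin 2) (Fin 2) ℝ) :=
    inferInstanceAs (SecondCountableTopology (Fin 2 → Fin 2 → ℝ))
  (Matrix.SpecialLinearGroup.isClosedEmbedding_val
    (n := Fin 2) (R := ℝ)).isEmbedding.secondCountableTopology

theorem continuous_entry (i j : Fin 2) : Continuous fun g : SL(2, ℝ) => g i j :=
  (continuous_apply_apply i j).comp
    (Matrix.SpecialLinearGroup.isClosedEmbedding_val (n := Fin 2) (R := ℝ)).continuous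

theorem measurable_entry (i j : Fin 2) : Measurable fun g : SL(2, ℝ) => g i j :=
  (continuous_entry i j).measurable

theorem measurable_of_entries {α : Type*} [MeasurableSpace α] {f : α → SL(2, ℝ)}
    (hf : ∀ i j, Measurable fun a => f a i j) : Measurable f := by
  have hind : IsInducing fun g : SL(2, ℝ) => (fun i j => g i j : Fin 2 → Fin 2 → ℝ) :=
    (Matrix.SpecialLinearGroup.isClosedEmbedding_val (n := Fin 2) (R := ℝ)).isInducing
  have h : Measurable fun a => (fun i j => f a i j : Fin 2 → Fin 2 → ℝ) :=
    measurable_pi_iff.2 fun i => measurable_pi_iff.2 fun j => hf i j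
  refine measurable_of_isOpen fun U hU => ?_
  obtain ⟨V, hV, rfl⟩ := hind.isOpen_iff.1 hU
  exact h hV.measurableSet

theorem mul_entry (g h : SL(2, ℝ)) (i j : Fin 2) :
    (g * h) i j = g i 0 * h 0 j + g i 1 * h 1 j := by
  rw [Matrix.SpecialLinearGroup.coe_mul, Matrix.mul_apply, Fin.sum_univ_two]

theorem det_entries (g : SL(2, ℝ)) : g 0 0 * g 1 1 - g 0 1 * g 1 0 = 1 := by
  rw [← Matrix.det_fin_two]; exact g.2

theorem sl_ext {g h : SL(2, ℝ)} (h00 : g 0 0 = h 0 0) (h01 : g 0 1 = h 0 1)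
    (h10 : g 1 0 = h 1 0) (h11 : g 1 1 = h 1 1) : g = h := by
  ext i j
  fin_cases i <;> fin_cases j <;> assumption

/-- `SL(2, ℝ)` equals its commutator subgroup, so the modular character, having commutative target,
is trivial. -/
instance instIsMulRightInvariantHaarSL :
    (Measure.haar : Measure SL(2, ℝ)).IsMulRightInvariant := by
  have htriv : ∀ g : SL(2, ℝ), Measure.modularCharacter g = 1 := by
    intro g
    let χ : SL(2, ℝ) →* NNRealˣ := (Measure.modularCharacter (G := SL(2, ℝ))).toHomUnits
    have hker : commutator SL(2, ℝ) ≤ χ.ker := Abelianization.commutator_subset_ker χ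
    rw [Matrix.SL2.commutator_eq_top (a := (2 : ℝ)) two_ne_zero (by norm_num)] at hker
    have := hker (Subgroup.mem_top g)
    rw [MonoidHom.mem_ker] at this
    simpa [χ] using congrArg Units.val this
  refine ⟨fun g => ?_⟩
  rw [Measure.map_right_mul_eq_modularCharacterFun_smul]
  have : Measure.modularCharacterFun g = 1 := htriv g
  rw [this, one_smul]

/-! ### Haar measure in the coordinates (bottom row, horocyclic parameter) -/

/-- The matrix with bottom row `v` and top row `s v + (1 / v.2, 0)` (the identity if
`v.2 = 0`). -/
def rowMatrix (v : ℝ × ℝ) (s : ℝ) : SL(2, ℝ) :=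
  if h : v.2 = 0 then 1 else
    ⟨!![s * v.1 + v.2⁻¹, s * v.2; v.1, v.2], by
      rw [Matrix.det_fin_two_of]; field_simp; ring⟩

theorem rowMatrix_zero_zero {v : ℝ × ℝ} (h : v.2 ≠ 0) (s : ℝ) :
    rowMatrix v s 0 0 = s * v.1 + v.2⁻¹ := by
  simp [rowMatrix, h]

theorem rowMatrix_zero_one {v : ℝ × ℝ} (h : v.2 ≠ 0) (s : ℝ) :
    rowMatrix v s 0 1 = s * v.2 := by simp [rowMatrix, h]

theorem rowMatrix_one_zero {v : ℝ × ℝ} (h : v.2 ≠ 0) (s : ℝ) :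
    rowMatrix v s 1 0 = v.1 := by simp [rowMatrix, h]

theorem rowMatrix_one_one {v : ℝ × ℝ} (h : v.2 ≠ 0) (s : ℝ) :
    rowMatrix v s 1 1 = v.2 := by simp [rowMatrix, h]

theorem measurable_rowMatrix : Measurable fun p : (ℝ × ℝ) × ℝ => rowMatrix p.1 p.2 := by
  have key : ∀ i j, (fun p : (ℝ × ℝ) × ℝ => rowMatrix p.1 p.2 i j) = fun p =>
      if p.1.2 = 0 then (1 : SL(2, ℝ)) i j
      else !![p.2 * p.1.1 + p.1.2⁻¹, p.2 * p.1.2; p.1.1, p.1.2] i j := by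
    intro i j
    ext p
    by_cases h : p.1.2 = 0 <;> simp [rowMatrix, h]
  refine measurable_of_entries fun i j => ?_
  rw [key]
  refine Measurable.ite (measurableSet_eq_fun (by fun_prop) (by fun_prop)) (by fun_prop) ?_
  fin_cases i <;> fin_cases j <;> simp <;> fun_prop

/-- The pushforward of Lebesgue measure under `rowMatrix`. -/
def coordMeasure : Measure SL(2, ℝ) :=
  ((volume : Measure (ℝ × ℝ)).prod (volume : Measure ℝ)).map fun p => rowMatrix p.1 p.2

/-- The linear action of `h` on row vectors. -/
def rowMap (h : SL(2, ℝ)) (v : ℝ × ℝ) : ℝ × ℝ :=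
  (v.1 * h 0 0 + v.2 * h 1 0, v.1 * h 0 1 + v.2 * h 1 1)

theorem measurePreserving_rowMap (h : SL(2, ℝ)) :
    MeasurePreserving (rowMap h) (volume : Measure (ℝ × ℝ)) volume := by
  let A : ℝ × ℝ →ₗ[ℝ] ℝ × ℝ := Matrix.toLin (Module.Basis.finTwoProd ℝ) (Module.Basis.finTwoProd ℝ)
    !![h 0 0, h 1 0; h 0 1, h 1 1]
  have hA : rowMap h = A := by
    ext v <;> simp only [A, Matrix.toLin_finTwoProd_apply, rowMap] <;> ring
  have hdet : LinearMap.det A = 1 := by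
    simp only [A]
    rw [LinearMap.det_toLin, Matrix.det_fin_two_of]
    linarith [det_entries h]
  refine ⟨?_, ?_⟩
  · unfold rowMap; fun_prop
  · rw [hA, Measure.map_linearMap_addHaar_eq_smul_addHaar _ (by rw [hdet]; exact one_ne_zero),
      hdet]
    simp

theorem ae_snd_ne_zero : ∀ᵐ v : ℝ × ℝ, v.2 ≠ 0 := by
  have : (volume : Measure (ℝ × ℝ)) (Set.univ ×ˢ {0}) = 0 := by
    rw [Measure.volume_eq_prod, Measure.prod_prod]; simp
  refine measure_mono_null (fun v hv => ?_) this
  simpa using hv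

/-- In these coordinates right multiplication is a skew product: a linear map of determinant one on
`v`, and a translation of `s` by an amount depending only on `v`. This is what makes Lebesgue
measure right invariant. -/
theorem rowMatrix_mul {v : ℝ × ℝ} (h : SL(2, ℝ)) (s : ℝ) (hv : v.2 ≠ 0)
    (hw : (rowMap h v).2 ≠ 0) :
    rowMatrix v s * h = rowMatrix (rowMap h v) (s + h 0 1 / (v.2 * (rowMap h v).2)) := by
  have hd := det_entries h
  have h11 : (rowMatrix v s * h) 1 1 = (rowMap h v).2 := by
    rw [mul_entry, rowMatrix_one_zero hv, rowMatrix_one_one hv]; rfl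
  have h10 : (rowMatrix v s * h) 1 0 = (rowMap h v).1 := by
    rw [mul_entry, rowMatrix_one_zero hv, rowMatrix_one_one hv]; rfl
  have h01 : (rowMatrix v s * h) 0 1 =
      rowMatrix (rowMap h v) (s + h 0 1 / (v.2 * (rowMap h v).2)) 0 1 := by
    rw [mul_entry, rowMatrix_zero_zero hv, rowMatrix_zero_one hv, rowMatrix_zero_one hw]
    field_simp
    simp only [rowMap]
    ring
  have e1 := det_entries (rowMatrix v s * h)
  have e2 := det_entries (rowMatrix (rowMap h v) (s + h 0 1 / (v.2 * (rowMap h v).2)))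
  rw [rowMatrix_one_one hw, rowMatrix_one_zero hw] at e2
  rw [h11, h10, h01] at e1
  refine sl_ext ?_ h01 ?_ ?_
  · exact mul_right_cancel₀ hw (by linarith)
  · rw [h10, rowMatrix_one_zero hw]
  · rw [h11, rowMatrix_one_one hw]

instance instIsMulRightInvariantCoordMeasure : coordMeasure.IsMulRightInvariant := by
  refine ⟨fun h => ?_⟩
  have hT : MeasurePreserving
      (fun p : (ℝ × ℝ) × ℝ => (rowMap h p.1, h 0 1 / (p.1.2 * (rowMap h p.1).2) + p.2))
      ((volume : Measure (ℝ × ℝ)).prod (volume : Measure ℝ))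
      ((volume : Measure (ℝ × ℝ)).prod (volume : Measure ℝ)) := by
    refine (measurePreserving_rowMap h).skew_product
      (g := fun v s => h 0 1 / (v.2 * (rowMap h v).2) + s) ?_ (ae_of_all _ fun v => ?_)
    · have := (measurePreserving_rowMap h).measurable
      simp only [Function.uncurry_def]
      fun_prop
    · exact (measurePreserving_add_left volume _).map_eq
  have hae : ∀ᵐ p ∂((volume : Measure (ℝ × ℝ)).prod (volume : Measure ℝ)),
      p.1.2 ≠ 0 ∧ (rowMap h p.1).2 ≠ 0 := by
    have h1 : ∀ᵐ v : ℝ × ℝ, v.2 ≠ 0 ∧ (rowMap h v).2 ≠ 0 :=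
      ae_snd_ne_zero.and ((measurePreserving_rowMap h).quasiMeasurePreserving.ae ae_snd_ne_zero)
    exact Measure.quasiMeasurePreserving_fst.ae h1
  rw [coordMeasure, Measure.map_map (measurable_mul_const h) measurable_rowMatrix]
  conv_rhs => rw [← hT.map_eq, Measure.map_map measurable_rowMatrix hT.measurable]
  refine Measure.map_congr ?_
  filter_upwards [hae] with p hp
  simp only [Function.comp_apply]
  rw [rowMatrix_mul h p.2 hp.1 hp.2, add_comm]

/-- Required by the uniqueness theorem for invariant measures. The exhausting sets bound the three
coordinates, the parameter `s` being recovered as `g 0 1 / g 1 1`. -/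
instance instSigmaFiniteCoordMeasure : SigmaFinite coordMeasure := by
  let A : ℕ → Set SL(2, ℝ) := fun n => {g | |g 1 0| ≤ n ∧ |g 1 1| ≤ n ∧ |g 0 1 / g 1 1| ≤ n}
  have hAm : ∀ n, MeasurableSet (A n) := fun n => by
    have h := measurable_entry
    have h1 := h 1 0
    have h2 := h 1 1
    have h3 := (h 0 1).div (h 1 1)
    exact (measurableSet_le (continuous_abs.measurable.comp h1) measurable_const).inter
      ((measurableSet_le (continuous_abs.measurable.comp h2) measurable_const).inter
      (measurableSet_le (continuous_abs.measurable.comp h3) measurable_const))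
  refine ⟨⟨⟨A, fun _ => trivial, fun n => ?_, ?_⟩⟩⟩
  · rw [coordMeasure, Measure.map_apply measurable_rowMatrix (hAm n)]
    have hB : ((volume : Measure (ℝ × ℝ)).prod (volume : Measure ℝ))
        ((Set.Icc (-n : ℝ) n ×ˢ Set.Icc (-n : ℝ) n) ×ˢ Set.Icc (-n : ℝ) n) < ∞ := by
      rw [Measure.volume_eq_prod, Measure.prod_prod, Measure.prod_prod]
      simp [Real.volume_Icc, ENNReal.mul_lt_top]
    refine lt_of_le_of_lt (measure_mono_ae ?_) hB
    filter_upwards [Measure.quasiMeasurePreserving_fst.ae ae_snd_ne_zero] with p hp hpA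
    obtain ⟨h1, h2, h3⟩ := hpA
    rw [rowMatrix_one_zero hp] at h1
    rw [rowMatrix_one_one hp] at h2
    rw [rowMatrix_one_one hp, rowMatrix_zero_one hp, mul_div_cancel_right₀ _ hp] at h3
    exact ⟨⟨abs_le.1 h1, abs_le.1 h2⟩, abs_le.1 h3⟩
  · refine Set.eq_univ_of_forall fun g => ?_
    obtain ⟨n, hn⟩ := exists_nat_ge (max |g 1 0| (max |g 1 1| |g 0 1 / g 1 1|))
    simp only [max_le_iff] at hn
    exact Set.mem_iUnion.2 ⟨n, hn⟩

/-- Haar measure is a multiple of `coordMeasure`. -/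
theorem exists_haar_eq_smul_coordMeasure : ∃ c : ℝ≥0∞, c ≠ 0 ∧ c ≠ ∞ ∧
    (Measure.haar : Measure SL(2, ℝ)) = c • coordMeasure := by
  let B : Set SL(2, ℝ) := {g | g 1 0 ∈ Set.Ioo (0 : ℝ) 1 ∧ g 1 1 ∈ Set.Ioo (1 : ℝ) 2 ∧
    g 0 1 / g 1 1 ∈ Set.Ioo (0 : ℝ) 1}
  have hBm : MeasurableSet B :=
    (measurable_entry 1 0 measurableSet_Ioo).inter ((measurable_entry 1 1 measurableSet_Ioo).inter
      ((measurable_entry 0 1).div (measurable_entry 1 1) measurableSet_Ioo))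
  have hB : coordMeasure B = 1 := by
    have : ((volume : Measure (ℝ × ℝ)).prod (volume : Measure ℝ))
        ((Set.Ioo (0 : ℝ) 1 ×ˢ Set.Ioo (1 : ℝ) 2) ×ˢ Set.Ioo (0 : ℝ) 1) = 1 := by
      rw [Measure.volume_eq_prod, Measure.prod_prod, Measure.prod_prod]
      simp [Real.volume_Ioo]; norm_num
    rw [coordMeasure, Measure.map_apply measurable_rowMatrix hBm, ← this]
    refine measure_congr ?_
    filter_upwards [Measure.quasiMeasurePreserving_fst.ae ae_snd_ne_zero] with p hp
    refine propext ?_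
    change (rowMatrix p.1 p.2 1 0 ∈ Set.Ioo (0 : ℝ) 1 ∧ rowMatrix p.1 p.2 1 1 ∈ Set.Ioo (1 : ℝ) 2 ∧
      rowMatrix p.1 p.2 0 1 / rowMatrix p.1 p.2 1 1 ∈ Set.Ioo (0 : ℝ) 1) ↔ _
    rw [rowMatrix_one_zero hp, rowMatrix_one_one hp, rowMatrix_zero_one hp,
      mul_div_cancel_right₀ _ hp, ← and_assoc]
    rfl
  -- Uniqueness is applied to left-invariant measures, so both right-invariant measures are first
  -- transported by inversion. The box `B` has coordinate measure one, hence the proportionality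
  -- constant is its Haar measure.
  have hBinv : coordMeasure.inv B⁻¹ = 1 := by rw [Measure.inv_apply, inv_inv, hB]
  have key := measure_eq_div_smul (Measure.haar : Measure SL(2, ℝ)).inv coordMeasure.inv
    (s := B⁻¹) (by rw [hBinv]; exact one_ne_zero) (by rw [hBinv]; exact ENNReal.one_ne_top)
  have hhaar : (Measure.haar : Measure SL(2, ℝ)) = (Measure.haar : Measure SL(2, ℝ)) B •
      coordMeasure := by
    rw [hBinv, div_one, Measure.inv_apply, inv_inv] at key
    ext S hS
    have := congrArg (fun m : Measure SL(2, ℝ) => m S⁻¹) key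
    simpa using this
  refine ⟨_, ?_, ?_, hhaar⟩
  · intro h0
    rw [h0, zero_smul] at hhaar
    exact NeZero.ne _ hhaar
  · intro h0
    rw [h0] at hhaar
    -- An infinite constant would give every set measure zero or infinity, contradicting a compact
    -- neighbourhood of the identity.
    obtain ⟨C, hC, hC1⟩ := exists_compact_mem_nhds (1 : SL(2, ℝ))
    have hfin := hC.measure_lt_top (μ := (Measure.haar : Measure SL(2, ℝ)))
    have hpos := Measure.measure_pos_of_mem_nhds (Measure.haar : Measure SL(2, ℝ)) hC1
    rw [hhaar, Measure.smul_apply, smul_eq_mul] at hfin hpos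
    by_cases hz : coordMeasure C = 0
    · simp [hz] at hpos
    · simp [ENNReal.top_mul hz] at hfin

/-- The bottom row of a matrix. -/
def row (g : SL(2, ℝ)) : ℝ × ℝ := (g 1 0, g 1 1)

theorem row_mul (g h : SL(2, ℝ)) : row (g * h) = rowMap h (row g) := by
  simp [row, rowMap, mul_entry]

theorem continuous_row : Continuous row := (continuous_entry 1 0).prodMk (continuous_entry 1 1)

/-- Lets null sets be checked in the plane: it serves both for frontiers of hit sets and for
discarding edges of regions. -/
theorem haar_row_preimage_null {N : Set (ℝ × ℝ)} (hN : volume N = 0) :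
    (Measure.haar : Measure SL(2, ℝ)) (row ⁻¹' N) = 0 := by
  obtain ⟨c, -, -, hc⟩ := exists_haar_eq_smul_coordMeasure
  obtain ⟨M, hNM, hM, hM0⟩ := exists_measurable_superset_of_null hN
  refine measure_mono_null (Set.preimage_mono hNM) ?_
  rw [hc, Measure.smul_apply, coordMeasure,
    Measure.map_apply measurable_rowMatrix (continuous_row.measurable hM)]
  have : ((volume : Measure (ℝ × ℝ)).prod (volume : Measure ℝ)) (M ×ˢ Set.univ) = 0 := by
    rw [Measure.prod_prod, hM0, zero_mul]
  rw [measure_mono_null_ae ?_ this, smul_zero]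
  filter_upwards [Measure.quasiMeasurePreserving_fst.ae ae_snd_ne_zero] with p hp hpM
  have : row (rowMatrix p.1 p.2) ∈ M := hpM
  rw [row, rowMatrix_one_zero hp, rowMatrix_one_one hp] at this
  exact ⟨this, trivial⟩

/-! ### Matrix entries -/

@[simp] theorem geodesicMatrix_zero_zero (t : ℝ) : geodesicMatrix t 0 0 = Real.exp (t / 2) := rfl

@[simp] theorem geodesicMatrix_zero_one (t : ℝ) : geodesicMatrix t 0 1 = 0 := rfl

@[simp] theorem geodesicMatrix_one_zero (t : ℝ) : geodesicMatrix t 1 0 = 0 := rfl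

@[simp] theorem geodesicMatrix_one_one (t : ℝ) : geodesicMatrix t 1 1 = Real.exp (-(t / 2)) := rfl

@[simp] theorem unstableMatrix_zero_zero (s : ℝ) : unstableMatrix s 0 0 = 1 := rfl

@[simp] theorem unstableMatrix_zero_one (s : ℝ) : unstableMatrix s 0 1 = 0 := rfl

@[simp] theorem unstableMatrix_one_zero (s : ℝ) : unstableMatrix s 1 0 = -s := rfl

@[simp] theorem unstableMatrix_one_one (s : ℝ) : unstableMatrix s 1 1 = 1 := rfl

@[simp] theorem stableMatrix_zero_zero (s : ℝ) : stableMatrix s 0 0 = 1 := rfl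

@[simp] theorem stableMatrix_zero_one (s : ℝ) : stableMatrix s 0 1 = s := rfl

@[simp] theorem stableMatrix_one_zero (s : ℝ) : stableMatrix s 1 0 = 0 := rfl

@[simp] theorem stableMatrix_one_one (s : ℝ) : stableMatrix s 1 1 = 1 := rfl

/-! ### Flow-box coordinates -/

/-- The point reached from the section coordinates `(s, t)` by flowing back for time `r`. -/
def flowBox (s t r : ℝ) : SL(2, ℝ) := stableMatrix s * geodesicMatrix t * unstableMatrix (-r)

theorem flowBox_one_zero (s t r : ℝ) : flowBox s t r 1 0 = r * Real.exp (-(t / 2)) := by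
  simp [flowBox, mul_entry, mul_comm]

theorem flowBox_one_one (s t r : ℝ) : flowBox s t r 1 1 = Real.exp (-(t / 2)) := by
  simp [flowBox, mul_entry]

theorem flowBox_zero_one (s t r : ℝ) : flowBox s t r 0 1 = s * Real.exp (-(t / 2)) := by
  simp [flowBox, mul_entry]

/-- A matrix with nonzero lower right entry is determined by its bottom row and its upper right
entry. -/
theorem sl_ext_of_ne_zero {g h : SL(2, ℝ)} (h01 : g 0 1 = h 0 1)
    (h10 : g 1 0 = h 1 0) (h11 : g 1 1 = h 1 1) (h0 : g 1 1 ≠ 0) : g = h := by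
  refine sl_ext ?_ h01 h10 h11
  have e1 := det_entries g
  have e2 := det_entries h
  rw [← h11, ← h10, ← h01] at e2
  exact mul_right_cancel₀ h0 (by linarith)

theorem rowMatrix_eq_flowBox (s t r : ℝ) :
    rowMatrix (r * Real.exp (-(t / 2)), Real.exp (-(t / 2))) s = flowBox s t r := by
  have h : ((r * Real.exp (-(t / 2)), Real.exp (-(t / 2))) : ℝ × ℝ).2 ≠ 0 :=
    (Real.exp_pos _).ne'
  refine sl_ext_of_ne_zero ?_ ?_ ?_ ?_
  · rw [rowMatrix_zero_one h, flowBox_zero_one]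
  · rw [rowMatrix_one_zero h, flowBox_one_zero]
  · rw [rowMatrix_one_one h, flowBox_one_one]
  · rw [rowMatrix_one_one h]; exact h

theorem eq_flowBox {g : SL(2, ℝ)} (h : 0 < g 1 1) :
    g = flowBox (g 0 1 / g 1 1) (-(2 * Real.log (g 1 1))) (g 1 0 / g 1 1) := by
  have he : Real.exp (-(-(2 * Real.log (g 1 1)) / 2)) = g 1 1 := by
    rw [show -(-(2 * Real.log (g 1 1)) / 2) = Real.log (g 1 1) by ring, Real.exp_log h]
  refine sl_ext_of_ne_zero ?_ ?_ ?_ h.ne'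
  · rw [flowBox_zero_one, he, div_mul_cancel₀ _ h.ne']
  · rw [flowBox_one_zero, he, div_mul_cancel₀ _ h.ne']
  · rw [flowBox_one_one, he]

theorem measurable_flowBox : Measurable fun p : ℝ × ℝ × ℝ => flowBox p.1 p.2.1 p.2.2 := by
  simp_rw [← rowMatrix_eq_flowBox]
  exact measurable_rowMatrix.comp (f := fun p : ℝ × ℝ × ℝ =>
    ((p.2.2 * Real.exp (-(p.2.1 / 2)), Real.exp (-(p.2.1 / 2))), p.1)) (by fun_prop)

theorem lintegral_scale {y : ℝ} (hy : 0 < y) (f : ℝ → ℝ≥0∞) :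
    ∫⁻ x, f x = ∫⁻ r, ENNReal.ofReal y * f (r * y) := by
  have h := lintegral_image_eq_lintegral_abs_deriv_mul (s := Set.univ) (f := fun r : ℝ => r * y)
    (f' := fun _ => y) MeasurableSet.univ
    (fun x _ => by simpa using ((hasDerivAt_id x).mul_const y))
    (fun a _ b _ hab => mul_right_cancel₀ hy.ne' hab) f
  rw [Set.image_univ, Set.range_eq_univ.2 fun x => ⟨x / y, div_mul_cancel₀ _ hy.ne'⟩] at h
  simpa [abs_of_pos hy] using h

theorem lintegral_Ioi_exp_substitution (f : ℝ → ℝ≥0∞) :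
    ∫⁻ y in Set.Ioi 0, f y =
      ∫⁻ t, ENNReal.ofReal (1 / 2 * Real.exp (-(t / 2))) * f (Real.exp (-(t / 2))) := by
  have h := lintegral_image_eq_lintegral_abs_deriv_mul (s := Set.univ)
    (f := fun t : ℝ => Real.exp (-(t / 2)))
    (f' := fun t => Real.exp (-(t / 2)) * (-(1 / 2))) MeasurableSet.univ
    (fun x _ => by
      have := ((hasDerivAt_id x).div_const 2).neg.exp
      simpa using this)
    (fun a _ b _ hab => by have := Real.exp_injective hab; linarith) f
  have himg : (fun t : ℝ => Real.exp (-(t / 2))) '' Set.univ = Set.Ioi 0 := by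
    ext y
    simp only [Set.image_univ, Set.mem_range, Set.mem_Ioi]
    refine ⟨?_, fun hy => ⟨-(2 * Real.log y), ?_⟩⟩
    · rintro ⟨t, rfl⟩; exact Real.exp_pos _
    · rw [show -(-(2 * Real.log y) / 2) = Real.log y by ring, Real.exp_log hy]
  rw [himg, setLIntegral_univ] at h
  rw [h]
  refine lintegral_congr fun t => ?_
  congr 2
  rw [abs_mul, abs_of_pos (Real.exp_pos _), abs_neg]
  norm_num [mul_comm]

/-- Haar measure on the set of matrices with positive lower right entry, in flow-box
coordinates. -/
theorem exists_haar_flowBox : ∃ c : ℝ≥0∞, c ≠ 0 ∧ c ≠ ∞ ∧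
    ∀ f : SL(2, ℝ) → ℝ≥0∞, Measurable f →
      ∫⁻ g in {g | 0 < g 1 1}, f g ∂Measure.haar =
        c * ∫⁻ s, ∫⁻ t, ∫⁻ r, f (flowBox s t r) * ENNReal.ofReal (Real.exp (-t)) := by
  obtain ⟨c, hc0, hct, hc⟩ := exists_haar_eq_smul_coordMeasure
  -- With bottom row `(x, y) = (r e^{-t/2}, e^{-t/2})` one has `|dy| = (1/2) e^{-t/2} dt` and `dx =
  -- e^{-t/2} dr`. Together these give the weight `e^{-t}` and the factor `1/2`.
  refine ⟨c * ENNReal.ofReal (1 / 2), mul_ne_zero hc0 (by simp), ENNReal.mul_ne_top hct (by simp),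
    fun f hf => ?_⟩
  have hm : MeasurableSet {g : SL(2, ℝ) | 0 < g 1 1} :=
    measurableSet_lt measurable_const (measurable_entry 1 1)
  let F : (ℝ × ℝ) → ℝ → ℝ≥0∞ := fun v s => Set.indicator {g | 0 < g 1 1} f (rowMatrix v s)
  have hF : Measurable fun p : (ℝ × ℝ) × ℝ => F p.1 p.2 :=
    (hf.indicator hm).comp measurable_rowMatrix
  have hFpos : ∀ v s, v.2 ≠ 0 → F v s =
      Set.indicator {v | 0 < v.2} (fun v => f (rowMatrix v s)) v := by
    intro v s hv
    simp only [F, Set.indicator, Set.mem_ofPred_eq, rowMatrix_one_one hv]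
  have hFae : ∀ s, ∫⁻ v, F v s = ∫⁻ v, Set.indicator {v : ℝ × ℝ | 0 < v.2}
      (fun v => f (rowMatrix v s)) v := fun s =>
    lintegral_congr_ae (ae_snd_ne_zero.mono fun v hv => hFpos v s hv)
  rw [hc, Measure.restrict_smul, lintegral_smul_measure, ← lintegral_indicator hm, coordMeasure,
    lintegral_map (hf.indicator hm) measurable_rowMatrix, smul_eq_mul, mul_assoc]
  congr 1
  rw [lintegral_prod_symm _ hF.aemeasurable, ← lintegral_const_mul' _ _ (by simp)]
  refine lintegral_congr fun s => ?_
  change ∫⁻ v, F v s = _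
  have hms : Measurable fun v : ℝ × ℝ => f (rowMatrix v s) :=
    hf.comp (measurable_rowMatrix.comp (by fun_prop : Measurable fun v : ℝ × ℝ => (v, s)))
  have hmpos : MeasurableSet {v : ℝ × ℝ | 0 < v.2} :=
    measurableSet_lt measurable_const measurable_snd
  rw [hFae, Measure.volume_eq_prod, lintegral_prod_symm _ (hms.indicator hmpos).aemeasurable]
  have hy : ∀ y, ∫⁻ x, Set.indicator {v : ℝ × ℝ | 0 < v.2} (fun v => f (rowMatrix v s)) (x, y) =
      Set.indicator (Set.Ioi 0) (fun y => ∫⁻ x, f (rowMatrix (x, y) s)) y := by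
    intro y
    by_cases h : 0 < y <;> simp [Set.indicator, h]
  simp_rw [hy]
  rw [lintegral_indicator measurableSet_Ioi, lintegral_Ioi_exp_substitution,
    ← lintegral_const_mul' _ _ (by simp)]
  refine lintegral_congr fun t => ?_
  rw [lintegral_scale (Real.exp_pos (-(t / 2))), ← lintegral_const_mul' _ _ ENNReal.ofReal_ne_top,
    ← lintegral_const_mul' _ _ ENNReal.ofReal_ne_top]
  refine lintegral_congr fun r => ?_
  rw [rowMatrix_eq_flowBox, ← mul_assoc, mul_comm (f _), ← mul_assoc,
    ← ENNReal.ofReal_mul (by positivity), ← ENNReal.ofReal_mul (by positivity), mul_assoc,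
    ← Real.exp_add]
  ring_nf

section

variable {Γ : Subgroup SL(2, ℝ)} {K : ℕ} {g : Fin K → SL(2, ℝ)}

/-! ### Discreteness of the orbits of bottom rows -/

theorem isCompact_entries_le (M : ℝ) : IsCompact {x : SL(2, ℝ) | ∀ i j, |x i j| ≤ M} := by
  have hc : IsCompact (Set.univ.pi fun _ : Fin 2 => Set.univ.pi fun _ : Fin 2 =>
      Set.Icc (-M) M) :=
    isCompact_univ_pi fun _ => isCompact_univ_pi fun _ => isCompact_Icc
  have := (Matrix.SpecialLinearGroup.isClosedEmbedding_val
    (n := Fin 2) (R := ℝ)).isCompact_preimage (K := (Set.univ.pi fun _ : Fin 2 => Set.univ.pi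
      fun _ : Fin 2 => Set.Icc (-M) M : Set (Matrix (Fin 2) (Fin 2) ℝ))) hc
  refine this.of_isClosed_subset ?_ ?_
  · simp only [Set.ofPred_forall]
    exact isClosed_iInter fun i => isClosed_iInter fun j =>
      isClosed_le (continuous_abs.comp (continuous_entry i j)) continuous_const
  · intro x hx i _ j _
    exact abs_le.1 (hx i j)

theorem finite_inter_of_isCompact [DiscreteTopology Γ] {C : Set SL(2, ℝ)} (hC : IsCompact C) :
    ((Γ : Set SL(2, ℝ)) ∩ C).Finite := by
  have h := Γ.tendsto_coe_cofinite_of_discrete (isDiscrete_iff_discreteTopology.2 inferInstance)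
  have h1 : ((↑) ⁻¹' C : Set Γ).Finite := by
    have := h hC.compl_mem_cocompact
    rw [mem_map, mem_cofinite] at this
    simpa using this
  refine (h1.image ((↑) : Γ → SL(2, ℝ))).subset ?_
  rintro x ⟨hx, hxC⟩
  exact ⟨⟨x, hx⟩, hxC, rfl⟩

theorem inv_entries (x : SL(2, ℝ)) :
    x⁻¹ 0 0 = x 1 1 ∧ x⁻¹ 0 1 = -x 0 1 ∧ x⁻¹ 1 0 = -x 1 0 ∧ x⁻¹ 1 1 = x 0 0 := by
  rw [Matrix.SpecialLinearGroup.coe_inv, Matrix.adjugate_fin_two]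
  simp

theorem conj_stableMatrix_entries (P : SL(2, ℝ)) (s : ℝ) :
    (P⁻¹ * stableMatrix s * P) 0 0 = 1 + s * (P 1 0 * P 1 1) ∧
    (P⁻¹ * stableMatrix s * P) 0 1 = s * (P 1 1 * P 1 1) ∧
    (P⁻¹ * stableMatrix s * P) 1 0 = -(s * (P 1 0 * P 1 0)) ∧
    (P⁻¹ * stableMatrix s * P) 1 1 = 1 - s * (P 1 0 * P 1 1) := by
  obtain ⟨h1, h2, h3, h4⟩ := inv_entries P
  have hd := det_entries P
  refine ⟨?_, ?_, ?_, ?_⟩ <;> simp only [mul_entry, h1, h2, h3, h4] <;> simp <;>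
    first | ring1 | linear_combination hd

/-- The vector `row (g κ * γ)` is encoded by the parabolic element `(g κ * γ)⁻¹ * stableMatrix 1 *
(g κ * γ)` of `Γ`. Its entries are quadratic in the vector, so bounded vectors give elements of `Γ`
in a compact set, of which there are finitely many. -/
theorem finite_row_orbit [DiscreteTopology Γ] (hg : IsCuspScaling Γ g) (κ : Fin K) (C : ℝ) :
    {v : ℝ × ℝ | (∃ γ : Γ, row (g κ * γ) = v) ∧ |v.1| ≤ C ∧ |v.2| ≤ C}.Finite := by
  have hfin := finite_inter_of_isCompact (Γ := Γ) (isCompact_entries_le (1 + C * C))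
  have hfin' := hfin.image fun x : SL(2, ℝ) => ((-x 1 0, x 0 1) : ℝ × ℝ)
  -- The off-diagonal entries of the parabolic element determine the vector up to the signs of its
  -- coordinates, so each fibre has at most four points.
  refine (hfin'.preimage' (f := fun v : ℝ × ℝ => (v.1 * v.1, v.2 * v.2)) ?_).subset ?_
  · rintro ⟨a, b⟩ -
    refine (Set.Finite.prod (Set.toFinite {√a, -√a}) (Set.toFinite {√b, -√b})).subset ?_
    rintro ⟨c, d⟩ h
    simp only [Set.mem_preimage, Set.mem_singleton_iff, Prod.mk.injEq] at h
    have aux : ∀ x y : ℝ, x * x = y → x ∈ ({√y, -√y} : Set ℝ) := by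
      rintro x y rfl
      rw [Real.sqrt_mul_self_eq_abs]
      rcases abs_choice x with h | h <;> simp [h]
    exact ⟨aux c a h.1, aux d b h.2⟩
  · rintro v ⟨⟨γ, rfl⟩, h1, h2⟩
    obtain ⟨e00, e01, e10, e11⟩ := conj_stableMatrix_entries (g κ * γ) 1
    refine ⟨(g κ * γ)⁻¹ * stableMatrix 1 * (g κ * γ), ⟨?_, ?_⟩, ?_⟩
    · have := (hg.width_one κ 1).2 ⟨1, by simp⟩
      have h := Γ.mul_mem (Γ.mul_mem (Γ.inv_mem γ.2) this) γ.2
      simpa [mul_assoc] using h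
    · simp only [row] at h1 h2
      have hC : 0 ≤ C := (abs_nonneg _).trans h1
      have b1 : |(g κ * (γ : SL(2, ℝ))) 1 0 * (g κ * (γ : SL(2, ℝ))) 1 1| ≤ C * C := by
        rw [abs_mul]; exact mul_le_mul h1 h2 (abs_nonneg _) hC
      have b2 : |(g κ * (γ : SL(2, ℝ))) 1 1 * (g κ * (γ : SL(2, ℝ))) 1 1| ≤ C * C := by
        rw [abs_mul]; exact mul_le_mul h2 h2 (abs_nonneg _) hC
      have b3 : |(g κ * (γ : SL(2, ℝ))) 1 0 * (g κ * (γ : SL(2, ℝ))) 1 0| ≤ C * C := by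
        rw [abs_mul]; exact mul_le_mul h1 h1 (abs_nonneg _) hC
      have hall : ∀ x : SL(2, ℝ), |x 0 0| ≤ 1 + C * C → |x 0 1| ≤ 1 + C * C →
          |x 1 0| ≤ 1 + C * C → |x 1 1| ≤ 1 + C * C → ∀ i j, |x i j| ≤ 1 + C * C := by
        intro x _ _ _ _ i j
        fin_cases i <;> fin_cases j <;> assumption
      rw [abs_le] at b1 b2 b3
      refine hall _ ?_ ?_ ?_ ?_
      · rw [e00, abs_le]; constructor <;> linarith
      · rw [e01, abs_le]; constructor <;> linarith
      · rw [e10, abs_le]; constructor <;> linarith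
      · rw [e11, abs_le]; constructor <;> linarith
    · simp only [e01, e10, row]; simp

theorem rowMap_inv_rowMap (x : SL(2, ℝ)) (v : ℝ × ℝ) : rowMap x⁻¹ (rowMap x v) = v := by
  obtain ⟨h1, h2, h3, h4⟩ := inv_entries x
  have hd := det_entries x
  ext <;> simp only [rowMap, h1, h2, h3, h4]
  · linear_combination v.1 * hd
  · linear_combination v.2 * hd

/-- Only finitely many vectors of the orbit are mapped to a bounded set by some element of a
given compact set. -/
theorem finite_row_orbit_of_isCompact [DiscreteTopology Γ] (hg : IsCuspScaling Γ g) (κ : Fin K)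
    {N : Set SL(2, ℝ)} (hN : IsCompact N) (C : ℝ) :
    {v : ℝ × ℝ | (∃ γ : Γ, row (g κ * γ) = v) ∧
      ∃ x ∈ N, |(rowMap x v).1| ≤ C ∧ |(rowMap x v).2| ≤ C}.Finite := by
  have hb : ∀ i j, ∃ M, ∀ x ∈ N, |x⁻¹ i j| ≤ M := fun i j => by
    obtain ⟨M, hM⟩ := hN.exists_bound_of_continuousOn
      (f := fun x : SL(2, ℝ) => x⁻¹ i j) ((continuous_entry i j).comp continuous_inv).continuousOn
    exact ⟨M, hM⟩
  choose M hM using hb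
  refine ((finite_row_orbit hg κ (max (C * M 0 0 + C * M 1 0) (C * M 0 1 + C * M 1 1)))).subset ?_
  rintro v ⟨hv, x, hx, h1, h2⟩
  refine ⟨hv, ?_⟩
  have hC : 0 ≤ C := (abs_nonneg _).trans h1
  rw [← rowMap_inv_rowMap x v]
  generalize rowMap x v = w at h1 h2
  have aux : ∀ a b c d : ℝ, ∀ A B : ℝ, |a| ≤ C → |b| ≤ A → |c| ≤ C → |d| ≤ B →
      |a * b + c * d| ≤ C * A + C * B := by
    intro a b c d A B ha hb hc hd
    refine (abs_add_le _ _).trans (add_le_add ?_ ?_) <;> rw [abs_mul]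
    · exact mul_le_mul ha hb (abs_nonneg _) hC
    · exact mul_le_mul hc hd (abs_nonneg _) hC
  exact ⟨(aux _ _ _ _ _ _ h1 (hM 0 0 x hx) h2 (hM 1 0 x hx)).trans (le_max_left _ _),
    (aux _ _ _ _ _ _ h1 (hM 0 1 x hx) h2 (hM 1 1 x hx)).trans (le_max_right _ _)⟩

/-! ### Rigidity of the cusp stabilisers -/

theorem eq_of_int_mul_eq_one {x y : ℝ} (hx : 0 < x) (hxy : x * y = 1) (hxi : ∃ m : ℤ, x = m)
    (hyi : ∃ m : ℤ, y = m) : x = 1 := by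
  obtain ⟨m, rfl⟩ := hxi
  obtain ⟨n, rfl⟩ := hyi
  have hm : 0 < m := by exact_mod_cast hx
  have hmn : m * n = 1 := by exact_mod_cast hxy
  have := Int.eq_one_or_neg_one_of_mul_eq_one hmn
  rcases this with rfl | rfl
  · simp
  · omega

/-- Such a matrix fixes `∞`, so `γ` carries cusp `κ` to cusp `ℓ` and inequivalence forces them to
agree. It then normalises the width-one parabolic group, which excludes a nontrivial dilation. -/
theorem eq_of_lower_left_eq_zero (hg : IsCuspScaling Γ g) {κ ℓ : Fin K} (γ : Γ)
    (h0 : (g ℓ * (γ : SL(2, ℝ)) * (g κ)⁻¹) 1 0 = 0)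
    (hpos : 0 < (g ℓ * (γ : SL(2, ℝ)) * (g κ)⁻¹) 1 1) :
    κ = ℓ ∧ ∃ m : ℤ, g ℓ * (γ : SL(2, ℝ)) * (g κ)⁻¹ = stableMatrix m := by
  have hκ : κ = ℓ := by
    by_contra hne
    refine hg.inequivalent κ ℓ hne γ γ.2 ?_
    have hfix : Matrix.SpecialLinearGroup.toGL (g ℓ * (γ : SL(2, ℝ)) * (g κ)⁻¹) •
        (OnePoint.infty : OnePoint ℝ) = OnePoint.infty := by
      rw [OnePoint.smul_infty_eq_self_iff]
      exact h0
    rw [cuspOf, cuspOf, smul_smul, ← map_mul]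
    conv_rhs => rw [← hfix]
    rw [smul_smul, ← map_mul]
    congr 2
    group
  subst hκ
  refine ⟨rfl, ?_⟩
  set M := g κ * γ * (g κ)⁻¹ with hM
  have hdet := det_entries M
  rw [h0, mul_zero, sub_zero] at hdet
  have mem1 : ∀ s : ℝ, (∃ m : ℤ, s = m) → (g κ)⁻¹ * (M⁻¹ * stableMatrix s * M) * g κ ∈ Γ := by
    intro s hs
    have := Γ.mul_mem (Γ.mul_mem (Γ.inv_mem γ.2) ((hg.width_one κ s).2 hs)) γ.2
    convert this using 1
    rw [hM]; group
  have mem2 : ∀ s : ℝ, (∃ m : ℤ, s = m) → (g κ)⁻¹ * (M * stableMatrix s * M⁻¹) * g κ ∈ Γ := by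
    intro s hs
    have := Γ.mul_mem (Γ.mul_mem γ.2 ((hg.width_one κ s).2 hs)) (Γ.inv_mem γ.2)
    convert this using 1
    rw [hM]; group
  have hi := inv_entries M
  have e1 : M⁻¹ * stableMatrix 1 * M = stableMatrix (M 1 1 * M 1 1) := by
    obtain ⟨h1, h2, h3, h4⟩ := conj_stableMatrix_entries M 1
    refine sl_ext ?_ ?_ ?_ ?_
    · rw [h1, h0]; simp
    · rw [h2]; simp
    · rw [h3, h0]; simp
    · rw [h4, h0]; simp
  have e2 : M * stableMatrix 1 * M⁻¹ = stableMatrix (M 0 0 * M 0 0) := by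
    obtain ⟨h1, h2, h3, h4⟩ := conj_stableMatrix_entries M⁻¹ 1
    simp only [inv_inv, hi.2.2.1, hi.2.2.2, h0] at h1 h2 h3 h4
    refine sl_ext ?_ ?_ ?_ ?_
    · rw [h1]; simp
    · rw [h2]; simp
    · rw [h3]; simp
    · rw [h4]; simp
  have i1 := mem1 1 ⟨1, by simp⟩
  have i2 := mem2 1 ⟨1, by simp⟩
  rw [e1, hg.width_one] at i1
  rw [e2, hg.width_one] at i2
  -- Conjugating `stableMatrix 1` by `M` in the two directions shows that `(M 1 1)²` and `(M 0 0)²`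
  -- are integers; their product is one.
  have hsq : M 1 1 * M 1 1 = 1 :=
    eq_of_int_mul_eq_one (by positivity)
      (by rw [show M 1 1 * M 1 1 * (M 0 0 * M 0 0) = (M 0 0 * M 1 1) * (M 0 0 * M 1 1) by ring,
        hdet, one_mul]) i1 i2
  have h11 : M 1 1 = 1 := by nlinarith
  have h00 : M 0 0 = 1 := by rw [h11, mul_one] at hdet; exact hdet
  have hMs : M = stableMatrix (M 0 1) :=
    sl_ext (by simp [h00]) (by simp) (by simp [h0]) (by simp [h11])
  have hmem : (g κ)⁻¹ * stableMatrix (M 0 1) * g κ ∈ Γ := by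
    rw [← hMs, hM]
    convert γ.2 using 1
    group
  obtain ⟨m, hm⟩ := (hg.width_one κ _).1 hmem
  exact ⟨m, by rw [← hm]; exact hMs⟩

/-- Every orbit vector with positive second coordinate is the bottom row of a matrix whose
horocyclic coordinate lies in `[0, 1)`. -/
theorem exists_reduced (hg : IsCuspScaling Γ g) (κ : Fin K) (γ : Γ) (x : SL(2, ℝ))
    (h : (g κ * γ * x) 1 1 ≠ 0) : ∃ γ' : Γ, row (g κ * γ' * x) = row (g κ * γ * x) ∧
      (g κ * γ' * x) 0 1 / (g κ * γ' * x) 1 1 ∈ Set.Ico (0 : ℝ) 1 := by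
  set A := g κ * γ * x with hA
  have hmem := (hg.width_one κ (-⌊A 0 1 / A 1 1⌋ : ℝ)).2 ⟨-⌊A 0 1 / A 1 1⌋, by simp⟩
  refine ⟨⟨_, Γ.mul_mem hmem γ.2⟩, ?_⟩
  have hB : g κ * ((g κ)⁻¹ * stableMatrix (-⌊A 0 1 / A 1 1⌋ : ℝ) * g κ * γ) * x =
      stableMatrix (-⌊A 0 1 / A 1 1⌋ : ℝ) * A := by rw [hA]; group
  simp only [hB]
  have e10 : (stableMatrix (-⌊A 0 1 / A 1 1⌋ : ℝ) * A) 1 0 = A 1 0 := by simp [mul_entry]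
  have e11 : (stableMatrix (-⌊A 0 1 / A 1 1⌋ : ℝ) * A) 1 1 = A 1 1 := by simp [mul_entry]
  have e01 : (stableMatrix (-⌊A 0 1 / A 1 1⌋ : ℝ) * A) 0 1 / A 1 1 = Int.fract (A 0 1 / A 1 1) := by
    simp only [mul_entry, stableMatrix_zero_zero, stableMatrix_zero_one, Int.fract]
    field_simp
    ring
  refine ⟨?_, ?_⟩
  · rw [row, e10, e11]; rfl
  · rw [e11, e01]
    exact ⟨Int.fract_nonneg _, Int.fract_lt_one _⟩

end

section

variable {Γ : Subgroup SL(2, ℝ)} {K : ℕ} {g : Fin K → SL(2, ℝ)}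

/-! ### Sections and heights in terms of orbits of bottom rows -/

theorem mk_eq_mk {x y : SL(2, ℝ)} :
    UnitTangent.mk Γ x = UnitTangent.mk Γ y ↔ ∃ γ : Γ, γ * y = x := by
  exact Quotient.eq (r := MulAction.orbitRel Γ SL(2, ℝ))

theorem mk_surjective : Function.Surjective (UnitTangent.mk Γ) := Quotient.mk_surjective

@[simp] theorem rightMul_mk (h x : SL(2, ℝ)) :
    rightMul h (UnitTangent.mk Γ x) = UnitTangent.mk Γ (x * h) := rfl

/-- The set of matrices `x` for which some vector of the orbit of the cusp `κ` is mapped into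
`R κ` by `x`. -/
def hitSet (Γ : Subgroup SL(2, ℝ)) (g : Fin K → SL(2, ℝ)) (R : Fin K → Set (ℝ × ℝ)) :
    Set SL(2, ℝ) :=
  {x | ∃ κ, ∃ γ : Γ, row (g κ * γ * x) ∈ R κ}

/-- The projection of `hitSet` to the unit tangent bundle. -/
def hitQuot (Γ : Subgroup SL(2, ℝ)) (g : Fin K → SL(2, ℝ)) (R : Fin K → Set (ℝ × ℝ)) :
    Set (UnitTangent Γ) :=
  UnitTangent.mk Γ '' hitSet Γ g R

variable {R R' : Fin K → Set (ℝ × ℝ)}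

theorem coe_mul_mem_hitSet (γ : Γ) {x : SL(2, ℝ)} :
    (γ : SL(2, ℝ)) * x ∈ hitSet Γ g R ↔ x ∈ hitSet Γ g R := by
  refine exists_congr fun κ => ⟨?_, ?_⟩
  · rintro ⟨δ, hδ⟩
    exact ⟨δ * γ, by simpa [mul_assoc] using hδ⟩
  · rintro ⟨δ, hδ⟩
    exact ⟨δ * γ⁻¹, by simpa [mul_assoc] using hδ⟩

theorem mk_mem_hitQuot {x : SL(2, ℝ)} :
    UnitTangent.mk Γ x ∈ hitQuot Γ g R ↔ x ∈ hitSet Γ g R := by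
  refine ⟨?_, fun h => ⟨x, h, rfl⟩⟩
  rintro ⟨y, hy, hyx⟩
  obtain ⟨γ, rfl⟩ := mk_eq_mk.1 hyx
  exact (coe_mul_mem_hitSet γ).1 hy

theorem mk_preimage_hitQuot : UnitTangent.mk Γ ⁻¹' hitQuot Γ g R = hitSet Γ g R :=
  Set.ext fun _ => mk_mem_hitQuot

theorem mul_mem_hitSet {x h : SL(2, ℝ)} :
    x * h ∈ hitSet Γ g R ↔ x ∈ hitSet Γ g fun κ => rowMap h ⁻¹' R κ := by
  simp only [hitSet, Set.mem_ofPred_eq, Set.mem_preimage, ← row_mul, mul_assoc]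

theorem hitSet_mono (h : ∀ κ, R κ ⊆ R' κ) : hitSet Γ g R ⊆ hitSet Γ g R' :=
  fun _ ⟨κ, γ, hx⟩ => ⟨κ, γ, h κ hx⟩

theorem hitQuot_mono (h : ∀ κ, R κ ⊆ R' κ) : hitQuot Γ g R ⊆ hitQuot Γ g R' :=
  Set.image_mono (hitSet_mono h)

/-- The lift `stableMatrix s * geodesicMatrix t` has bottom row `(0, e^{-t/2})`, so `t ≥ σ κ + R`
becomes an upper bound for the second coordinate, and `s` drops out. -/
theorem mk_mem_multiSection (σ : Fin K → ℝ) (R : ℝ) (x : SL(2, ℝ)) :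
    UnitTangent.mk Γ x ∈ multiSection Γ g σ R ↔ x ∈ hitSet Γ g fun κ =>
      {v | v.1 = 0 ∧ 0 < v.2 ∧ v.2 ≤ Real.exp (-((σ κ + R) / 2))} := by
  simp only [multiSection, cuspSection, closedHorocycle, Set.mem_iUnion, Set.mem_image,
    Set.mem_range, hitSet, Set.mem_ofPred_eq, basePoint, stableFlow, geodesicFlow]
  refine exists_congr fun κ => ⟨?_, ?_⟩
  · rintro ⟨t, ht, _, ⟨s, rfl⟩, h⟩
    rw [rightMul_mk, rightMul_mk, mk_eq_mk] at h
    obtain ⟨γ, hγ⟩ := h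
    refine ⟨γ, ?_⟩
    rw [mul_assoc, hγ]
    have ht' : σ κ + R ≤ t := ht
    refine ⟨?_, ?_, ?_⟩
    · simp [row, mul_assoc, mul_entry]
    · simp [row, mul_assoc, mul_entry, Real.exp_pos]
    · simp only [row, mul_assoc, mul_inv_cancel_left]
      simp [mul_entry]
      linarith
  · rintro ⟨γ, h0, hpos, hle⟩
    have hbox := eq_flowBox (g := g κ * γ * x) hpos
    refine ⟨-(2 * Real.log ((g κ * γ * x) 1 1)), ?_, _,
      ⟨(g κ * γ * x) 0 1 / (g κ * γ * x) 1 1, rfl⟩, ?_⟩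
    · have := (Real.log_le_iff_le_exp hpos).2 hle
      change σ κ + R ≤ _
      change Real.log ((g κ * γ * x) 1 1) ≤ _ at this
      linarith
    · rw [rightMul_mk, rightMul_mk, mk_eq_mk]
      refine ⟨γ, ?_⟩
      have h0' : (g κ * γ * x) 1 0 = 0 := h0
      have hu : unstableMatrix (-0) = 1 := by
        refine sl_ext ?_ ?_ ?_ ?_ <;> simp
      rw [flowBox, h0', zero_div, hu, mul_one] at hbox
      rw [mul_assoc, ← hbox]
      group

theorem rowMap_unstableMatrix (r : ℝ) (v : ℝ × ℝ) :
    rowMap (unstableMatrix r) v = (v.1 - r * v.2, v.2) := by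
  ext <;> simp [rowMap]
  ring

theorem rowMap_geodesicMatrix (t : ℝ) (v : ℝ × ℝ) :
    rowMap (geodesicMatrix t) v = (v.1 * Real.exp (t / 2), v.2 * Real.exp (-(t / 2))) := by
  ext <;> simp [rowMap]

theorem unstableFlow_mk_mem_multiSection (σ : Fin K → ℝ) (r : ℝ) (x : SL(2, ℝ)) :
    unstableFlow r (UnitTangent.mk Γ x) ∈ multiSection Γ g σ 0 ↔ x ∈ hitSet Γ g fun κ =>
      {v | v.1 = r * v.2 ∧ 0 < v.2 ∧ v.2 ≤ Real.exp (-(σ κ / 2))} := by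
  rw [unstableFlow, rightMul_mk, mk_mem_multiSection, mul_mem_hitSet]
  simp only [hitSet, Set.mem_ofPred_eq, Set.mem_preimage, rowMap_unstableMatrix, sub_eq_zero,
    add_zero]

theorem sectionMap_eq_mk (w : ℝ × ℝ × Fin K) :
    sectionMap Γ g w =
      UnitTangent.mk Γ ((g w.2.2)⁻¹ * stableMatrix w.1 * geodesicMatrix w.2.1) := rfl

theorem stable_mul_geodesic (s t : ℝ) : stableMatrix s * geodesicMatrix t = flowBox s t 0 := by
  have hu : unstableMatrix (-0) = 1 := by refine sl_ext ?_ ?_ ?_ ?_ <;> simp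
  rw [flowBox, hu, mul_one]

theorem lt_relHeight_mk (hg : IsCuspScaling Γ g) (σ : Fin K → ℝ) {h : ℝ} (hh : 0 ≤ h)
    (x : SL(2, ℝ)) :
    (h : EReal) < relHeight g σ (UnitTangent.mk Γ x) ↔ x ∈ hitSet Γ g fun κ =>
      {v | v.1 = 0 ∧ 0 < v.2 ∧ v.2 < Real.exp (-((σ κ + h) / 2))} := by
  simp only [relHeight, lt_iSup_iff, EReal.coe_lt_coe_iff]
  constructor
  · rintro ⟨⟨s, t, κ⟩, ⟨-, hw⟩, hlt⟩
    rw [sectionMap_eq_mk, mk_eq_mk] at hw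
    obtain ⟨γ, hγ⟩ := hw
    simp only at hγ hlt
    refine ⟨κ, γ, ?_⟩
    rw [mul_assoc, hγ, mul_assoc, mul_inv_cancel_left, stable_mul_geodesic]
    simp only [Set.mem_ofPred_eq, row, flowBox_one_zero, flowBox_one_one, zero_mul, true_and,
      Real.exp_pos, Real.exp_lt_exp]
    linarith
  · rintro ⟨κ, γ, hv⟩
    -- Heights are defined with `s ∈ [0, 1)`, so `γ` is first adjusted by the cusp stabiliser; this
    -- leaves the bottom row unchanged.
    obtain ⟨γ', hrow, hs⟩ := exists_reduced hg κ γ x hv.2.1.ne'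
    rw [← hrow] at hv
    obtain ⟨h0, hpos, hlt⟩ := hv
    have hbox := eq_flowBox (g := g κ * γ' * x) hpos
    have h0' : (g κ * γ' * x) 1 0 = 0 := h0
    rw [h0', zero_div, ← stable_mul_geodesic] at hbox
    have hlog := (Real.log_lt_iff_lt_exp hpos).2 hlt
    change Real.log ((g κ * γ' * x) 1 1) < _ at hlog
    refine ⟨⟨_, -(2 * Real.log ((g κ * γ' * x) 1 1)), κ⟩, ⟨⟨hs, ?_⟩, ?_⟩, ?_⟩
    · simp only; linarith
    · rw [sectionMap_eq_mk, mk_eq_mk]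
      refine ⟨γ', ?_⟩
      simp only
      rw [mul_assoc, ← hbox]
      group
    · simp only; linarith

theorem im_smul_I (x : SL(2, ℝ)) :
    (x • UpperHalfPlane.I).im = 1 / ((row x).1 ^ 2 + (row x).2 ^ 2) := by
  have h := UpperHalfPlane.im_smul_eq_div_normSq (Matrix.SpecialLinearGroup.toGL x) UpperHalfPlane.I
  refine h.trans ?_
  simp [UpperHalfPlane.denom, Complex.normSq_apply, row]
  ring

theorem exists_rotation {v : ℝ × ℝ} (hv : 0 < v.1 ^ 2 + v.2 ^ 2) :
    ∃ k : SL(2, ℝ), k • UpperHalfPlane.I = UpperHalfPlane.I ∧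
      rowMap k v = (0, √(v.1 ^ 2 + v.2 ^ 2)) := by
  set ρ := √(v.1 ^ 2 + v.2 ^ 2) with hρ
  have hρpos : 0 < ρ := Real.sqrt_pos.2 hv
  have hρ2 : ρ ^ 2 = v.1 ^ 2 + v.2 ^ 2 := Real.sq_sqrt hv.le
  have hdet : (!![v.2 / ρ, v.1 / ρ; -(v.1 / ρ), v.2 / ρ] : Matrix (Fin 2) (Fin 2) ℝ).det = 1 := by
    rw [Matrix.det_fin_two_of]
    field_simp
    linarith
  refine ⟨⟨!![v.2 / ρ, v.1 / ρ; -(v.1 / ρ), v.2 / ρ], hdet⟩, ?_, ?_⟩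
  · apply UpperHalfPlane.ext
    refine (UpperHalfPlane.coe_specialLinearGroup_apply _ _).trans ?_
    rw [div_eq_iff]
    · simp
      linear_combination (v.1 / ρ : ℂ) * Complex.I_mul_I
    · simp
      intro h
      have h1 := congrArg Complex.re h
      have h2 := congrArg Complex.im h
      simp [← Complex.ofReal_div] at h1 h2
      rcases h1 with h1 | h1
      · rcases h2 with h2 | h2
        · rw [h1, h2] at hv; simp at hv
        · exact hρpos.ne' h2
      · exact hρpos.ne' h1
  · ext
    · simp [rowMap]; ring
    · simp [rowMap]
      field_simp
      linarith

/-- Points over the same `y` have the same imaginary part after moving the cusp to `∞`, hence the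
same value of `v.1 ^ 2 + v.2 ^ 2`. Conversely a rotation fixing `i` turns `v` into `(0, |v|)`, which
is the lift on the section. -/
theorem lt_relHeightSurface_mk (hg : IsCuspScaling Γ g) (σ : Fin K → ℝ) {h : ℝ} (hh : 0 ≤ h)
    (x : SL(2, ℝ)) :
    (h : EReal) < relHeightSurface g σ (proj (UnitTangent.mk Γ x)) ↔ x ∈ hitSet Γ g fun κ =>
      {v | v.1 ^ 2 + v.2 ^ 2 < Real.exp (-(σ κ + h))} := by
  have hexp : ∀ κ, Real.exp (-(σ κ + h)) = Real.exp (-((σ κ + h) / 2)) ^ 2 := fun κ => by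
    rw [← Real.exp_nat_mul]; congr 1; push_cast; ring
  simp only [relHeightSurface, lt_iSup_iff]
  constructor
  · rintro ⟨y, ⟨-, hy⟩, hlt⟩
    obtain ⟨y, rfl⟩ := mk_surjective y
    rw [lt_relHeight_mk hg σ hh] at hlt
    obtain ⟨κ, γ, h0, hpos, hlt⟩ := hlt
    obtain ⟨δ, hδ⟩ := Quotient.exact hy
    have hδ' : ((δ : SL(2, ℝ)) * x) • UpperHalfPlane.I = y • UpperHalfPlane.I := by
      rw [mul_smul]; exact hδ
    refine ⟨κ, γ * δ, ?_⟩
    have him := congrArg (fun z => (((g κ * (γ : SL(2, ℝ))) • z : UpperHalfPlane)).im) hδ'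
    simp only [smul_smul] at him
    rw [im_smul_I, im_smul_I, one_div, one_div, inv_inj] at him
    simp only [Set.mem_ofPred_eq, Subgroup.coe_mul]
    rw [show g κ * ((γ : SL(2, ℝ)) * δ) * x = g κ * γ * (δ * x) by group, him, h0, hexp]
    nlinarith
  · rintro ⟨κ, γ, hv⟩
    have hne : 0 < (row (g κ * γ * x)).1 ^ 2 + (row (g κ * γ * x)).2 ^ 2 := by
      have hd := det_entries (g κ * γ * x)
      simp only [row]
      by_contra hcon
      have h1 : (g κ * γ * x) 1 0 = 0 := by
        nlinarith [sq_nonneg ((g κ * γ * x) 1 0), sq_nonneg ((g κ * γ * x) 1 1)]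
      have h2 : (g κ * γ * x) 1 1 = 0 := by
        nlinarith [sq_nonneg ((g κ * γ * x) 1 0), sq_nonneg ((g κ * γ * x) 1 1)]
      rw [h1, h2] at hd
      simp at hd
    obtain ⟨k, hkI, hk⟩ := exists_rotation hne
    have hlt : √((row (g κ * γ * x)).1 ^ 2 + (row (g κ * γ * x)).2 ^ 2) <
        Real.exp (-((σ κ + h) / 2)) := by
      rw [Real.sqrt_lt' (Real.exp_pos _), ← hexp]; exact hv
    refine ⟨UnitTangent.mk Γ (x * k), ⟨?_, ?_⟩, ?_⟩
    · rw [mk_mem_multiSection]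
      refine ⟨κ, γ, ?_⟩
      rw [← mul_assoc, row_mul, hk]
      refine ⟨rfl, Real.sqrt_pos.2 hne, hlt.le.trans (Real.exp_le_exp.2 ?_)⟩
      linarith
    · change Quotient.mk _ ((x * k) • UpperHalfPlane.I) = Quotient.mk _ (x • UpperHalfPlane.I)
      rw [mul_smul, hkI]
    · rw [lt_relHeight_mk hg σ hh]
      refine ⟨κ, γ, ?_⟩
      rw [← mul_assoc, row_mul, hk]
      exact ⟨rfl, Real.sqrt_pos.2 hne, hlt⟩

/-! ### The extreme value events -/

theorem mem_geodesicFlow_image {t : ℝ} {E : Set (UnitTangent Γ)} {x : SL(2, ℝ)} :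
    UnitTangent.mk Γ x ∈ geodesicFlow t '' E ↔ UnitTangent.mk Γ (x * geodesicMatrix (-t)) ∈ E := by
  have h1 : geodesicMatrix (-t) * geodesicMatrix t = 1 := by
    refine sl_ext ?_ ?_ ?_ ?_ <;> simp [mul_entry, ← Real.exp_add, neg_div]
  have h2 : geodesicMatrix t * geodesicMatrix (-t) = 1 := by
    refine sl_ext ?_ ?_ ?_ ?_ <;> simp [mul_entry, ← Real.exp_add, neg_div]
  constructor
  · rintro ⟨y, hy, hyx⟩
    obtain ⟨y, rfl⟩ := mk_surjective y
    rw [← rightMul_mk, ← hyx, geodesicFlow, rightMul_mk, rightMul_mk, mul_assoc, h2, mul_one]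
    exact hy
  · intro h
    exact ⟨_, h, by rw [geodesicFlow, rightMul_mk, mul_assoc, h1, mul_one]⟩

/-- The vectors which correspond to hitting the section `ℋ(σ, 0)`, above height zero, at a time
in `(0, e^{-H}]`. -/
def extremeRegion (σ : Fin K → ℝ) (H : ℝ) (κ : Fin K) : Set (ℝ × ℝ) :=
  {v | 0 < v.2 ∧ v.2 < Real.exp (-(σ κ / 2)) ∧ 0 < v.1 ∧ v.1 ≤ Real.exp (-H) * v.2}

/-- A closed neighbourhood of `extremeRegion`. -/
def thickRegion (σ : Fin K → ℝ) (H ε : ℝ) (κ : Fin K) : Set (ℝ × ℝ) :=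
  {v | 0 ≤ v.2 ∧ v.2 ≤ Real.exp (-(σ κ / 2)) ∧ -ε ≤ v.1 ∧ v.1 ≤ Real.exp (-H) * v.2 + ε}

theorem mk_mem_geodesicFlow_hitQuot {t : ℝ} {x : SL(2, ℝ)} :
    UnitTangent.mk Γ x ∈ geodesicFlow t '' hitQuot Γ g R ↔ ∃ κ, ∃ γ : Γ,
      ((row (g κ * γ * x)).1 * Real.exp (-(t / 2)), (row (g κ * γ * x)).2 * Real.exp (t / 2))
        ∈ R κ := by
  rw [mem_geodesicFlow_image, mk_mem_hitQuot, mul_mem_hitSet]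
  simp only [hitSet, Set.mem_ofPred_eq, Set.mem_preimage, rowMap_geodesicMatrix, neg_div, neg_neg]

/-- The renormalisation step: the choice `L = H + log T` makes the rescaled time bound `T e^{-L} =
e^{-H}` and the rescaled height bound `e^{-σ_κ/2}` independent of `T`. The condition `L ≥ 0` ensures
that a vector above the threshold also satisfies the bound defining the section. -/
theorem sectionExtreme_eq (hg : IsCuspScaling Γ g) (σ : Fin K → ℝ) {H T : ℝ} (hT : 0 < T)
    (hHT : 0 ≤ H + Real.log T) :
    {x₀ : UnitTangent Γ | ((H + Real.log T : ℝ) : EReal) <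
      ⨆ ξ ∈ hittingTimes g σ 0 x₀ ∩ Set.Icc 0 T, relHeight g σ (unstableFlow ξ x₀)} =
    geodesicFlow (H + Real.log T) '' hitQuot Γ g (extremeRegion σ H) := by
  ext x₀
  obtain ⟨x, rfl⟩ := mk_surjective x₀
  rw [mk_mem_geodesicFlow_hitQuot]
  simp only [lt_iSup_iff, Set.mem_ofPred_eq]
  set L := H + Real.log T with hL
  have hTL : T = Real.exp (-H) * Real.exp L := by
    rw [← Real.exp_add, hL, neg_add_cancel_left, Real.exp_log hT]
  have hLL : Real.exp (L / 2) * Real.exp (L / 2) = Real.exp L := by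
    rw [← Real.exp_add]; congr 1; ring
  have hLm : Real.exp (-(L / 2)) * Real.exp (L / 2) = 1 := by
    rw [← Real.exp_add]; simp
  have hsplit : ∀ κ, Real.exp (-((σ κ + L) / 2)) = Real.exp (-(σ κ / 2)) * Real.exp (-(L / 2)) :=
    fun κ => by rw [← Real.exp_add]; congr 1; ring
  have hp := Real.exp_pos (L / 2)
  have hm := Real.exp_pos (-(L / 2))
  have key : ∀ (κ : Fin K) (v : ℝ × ℝ), (v.1 * Real.exp (-(L / 2)), v.2 * Real.exp (L / 2)) ∈
      extremeRegion σ H κ ↔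
        0 < v.2 ∧ v.2 < Real.exp (-((σ κ + L) / 2)) ∧ 0 < v.1 ∧ v.1 ≤ T * v.2 := by
    intro κ v
    simp only [extremeRegion, Set.mem_ofPred_eq]
    refine and_congr (by rw [mul_pos_iff_of_pos_right hp]) (and_congr ?_ (and_congr
      (by rw [mul_pos_iff_of_pos_right hm]) ?_))
    · rw [hsplit, Real.exp_neg (L / 2), ← div_eq_mul_inv, lt_div_iff₀ hp]
    · rw [Real.exp_neg (L / 2), ← div_eq_mul_inv, div_le_iff₀ hp, hTL, ← hLL]
      ring_nf
  simp only [key]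
  constructor
  · rintro ⟨ξ, ⟨⟨hξ, -⟩, hξT⟩, hlt⟩
    rw [unstableFlow, rightMul_mk, lt_relHeight_mk hg σ hHT, mul_mem_hitSet] at hlt
    obtain ⟨κ, γ, h⟩ := hlt
    simp only [Set.mem_preimage, rowMap_unstableMatrix, Set.mem_ofPred_eq, sub_eq_zero] at h
    refine ⟨κ, γ, h.2.1, h.2.2, ?_, ?_⟩
    · rw [h.1]; exact mul_pos hξ h.2.1
    · rw [h.1]; exact mul_le_mul_of_nonneg_right hξT.2 h.2.1.le
  · rintro ⟨κ, γ, h1, h2, h3, h4⟩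
    set v := row (g κ * γ * x) with hv
    have hvv : v.1 = v.1 / v.2 * v.2 := by field_simp
    have hpos : 0 < v.1 / v.2 := div_pos h3 h1
    refine ⟨v.1 / v.2, ⟨⟨hpos, ?_⟩, hpos.le, (div_le_iff₀ h1).2 h4⟩, ?_⟩
    · rw [unstableFlow_mk_mem_multiSection]
      refine ⟨κ, γ, hvv, h1, h2.le.trans (Real.exp_le_exp.2 ?_)⟩
      linarith
    · rw [unstableFlow, rightMul_mk, lt_relHeight_mk hg σ hHT, mul_mem_hitSet]
      refine ⟨κ, γ, ?_⟩
      simp only [Set.mem_preimage, rowMap_unstableMatrix, Set.mem_ofPred_eq, sub_eq_zero]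
      exact ⟨hvv, h1, h2⟩

theorem mem_surfaceExtreme (hg : IsCuspScaling Γ g) (σ : Fin K → ℝ) {h T : ℝ}
    (hh : 0 ≤ h) (x : SL(2, ℝ)) :
    ((h : EReal) < ⨆ s ∈ Set.Icc 0 T,
      relHeightSurface g σ (proj (unstableFlow s (UnitTangent.mk Γ x)))) ↔
    ∃ s ∈ Set.Icc 0 T, ∃ κ, ∃ γ : Γ, ((row (g κ * γ * x)).1 - s * (row (g κ * γ * x)).2) ^ 2 +
      (row (g κ * γ * x)).2 ^ 2 < Real.exp (-(σ κ + h)) := by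
  simp only [lt_iSup_iff, exists_prop]
  refine exists_congr fun s => and_congr_right fun _ => ?_
  rw [unstableFlow, rightMul_mk, lt_relHeightSurface_mk hg σ hh, mul_mem_hitSet]
  simp only [hitSet, Set.mem_ofPred_eq, Set.mem_preimage, rowMap_unstableMatrix]

theorem sectionExtreme_subset_surfaceExtreme (hg : IsCuspScaling Γ g) (σ : Fin K → ℝ) {H T : ℝ}
    (hT : 0 < T) (hHT : 0 ≤ H + Real.log T) :
    geodesicFlow (H + Real.log T) '' hitQuot Γ g (extremeRegion σ H) ⊆
    {x₀ : UnitTangent Γ | ((H + Real.log T : ℝ) : EReal) <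
      ⨆ s ∈ Set.Icc 0 T, relHeightSurface g σ (proj (unstableFlow s x₀))} := by
  rw [← sectionExtreme_eq hg σ hT hHT]
  intro x₀ hx
  simp only [lt_iSup_iff, Set.mem_ofPred_eq] at hx ⊢
  obtain ⟨ξ, ⟨⟨h1, h2⟩, h3⟩, hlt⟩ := hx
  refine ⟨ξ, h3, hlt.trans_le ?_⟩
  exact le_iSup₂_of_le (f := fun x _ => relHeight g σ x) (unstableFlow ξ x₀) ⟨h2, rfl⟩ le_rfl

theorem surfaceExtreme_subset (hneg : (-1 : SL(2, ℝ)) ∈ Γ) (hg : IsCuspScaling Γ g)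
    (σ : Fin K → ℝ) {H T ε : ℝ}
    (hT : 0 < T) (hHT : 0 ≤ H + Real.log T)
    (hε : ∀ κ, Real.exp (-(σ κ / 2)) * Real.exp (-(H + Real.log T)) ≤ ε) :
    {x₀ : UnitTangent Γ | ((H + Real.log T : ℝ) : EReal) <
      ⨆ s ∈ Set.Icc 0 T, relHeightSurface g σ (proj (unstableFlow s x₀))} ⊆
    geodesicFlow (H + Real.log T) '' hitQuot Γ g (thickRegion σ H ε) := by
  intro x₀ hx
  obtain ⟨x, rfl⟩ := mk_surjective x₀
  rw [Set.mem_ofPred_eq, mem_surfaceExtreme hg σ hHT] at hx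
  rw [mk_mem_geodesicFlow_hitQuot]
  set L := H + Real.log T with hL
  have hTL : T = Real.exp (-H) * Real.exp L := by
    rw [← Real.exp_add, hL, neg_add_cancel_left, Real.exp_log hT]
  obtain ⟨s, hs, κ, γ, hv⟩ := hx
  -- The surface condition is even in `v`, and `-1 ∈ Γ` makes `-v` an orbit vector too, so the
  -- second coordinate may be taken nonnegative.
  obtain ⟨γ, h0, hv⟩ : ∃ γ : Γ, 0 ≤ (row (g κ * γ * x)).2 ∧
      ((row (g κ * γ * x)).1 - s * (row (g κ * γ * x)).2) ^ 2 + (row (g κ * γ * x)).2 ^ 2 <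
        Real.exp (-(σ κ + L)) := by
    rcases le_total 0 (row (g κ * γ * x)).2 with h | h
    · exact ⟨γ, h, hv⟩
    · refine ⟨⟨-1, hneg⟩ * γ, ?_⟩
      have hr : row (g κ * ((⟨-1, hneg⟩ * γ : Γ) : SL(2, ℝ)) * x) = -row (g κ * γ * x) := by
        rw [Subgroup.coe_mul]
        simp [row]
      rw [hr]
      refine ⟨by simpa using h, ?_⟩
      simp only [Prod.fst_neg, Prod.snd_neg]
      convert hv using 1
      ring
  refine ⟨κ, γ, ?_⟩
  generalize row (g κ * γ * x) = v at h0 hv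
  have hp := Real.exp_pos (L / 2)
  have hm := Real.exp_pos (-(L / 2))
  set a := Real.exp (-(L / 2)) with ha
  set b := Real.exp (L / 2) with hb
  set δ := Real.exp (-(σ κ / 2)) with hδ
  have hδpos : 0 < δ := Real.exp_pos _
  have hab : a * b = 1 := by rw [ha, hb, ← Real.exp_add]; simp
  have hexp : Real.exp (-(σ κ + L)) = (δ * a) ^ 2 := by
    rw [hδ, ha, ← Real.exp_add, ← Real.exp_nat_mul]; congr 1; push_cast; ring
  have haL : a * a = Real.exp (-L) := by rw [ha, ← Real.exp_add]; congr 1; ring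
  have hbL : b * b = Real.exp L := by rw [hb, ← Real.exp_add]; congr 1; ring
  rw [hexp] at hv
  have hda : 0 < δ * a := mul_pos hδpos hm
  -- A disc of radius `δ a` controls each coordinate. The error in `v.1` is multiplied by a further
  -- `a` when rescaled, giving thickness at most `δ a² = δ e^{-L} ≤ ε`.
  have h1 : |v.1 - s * v.2| < δ * a := abs_lt_of_sq_lt_sq (by nlinarith) hda.le
  have h2 : |v.2| < δ * a := abs_lt_of_sq_lt_sq (by nlinarith) hda.le
  have hε' := hε κ
  rw [← haL] at hε'
  rw [abs_lt] at h1 h2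
  have hsv : 0 ≤ s * v.2 := mul_nonneg hs.1 h0
  have hsT : s * v.2 ≤ T * v.2 := mul_le_mul_of_nonneg_right hs.2 h0
  have hTa : T * a = Real.exp (-H) * b := by
    rw [hTL, ← hbL]
    linear_combination Real.exp (-H) * b * hab
  refine ⟨mul_nonneg h0 hp.le, ?_, ?_, ?_⟩
  · calc v.2 * b ≤ δ * a * b := mul_le_mul_of_nonneg_right h2.2.le hp.le
      _ = δ := by rw [mul_assoc, hab, mul_one]
  · simp only
    nlinarith
  · simp only
    have h3 : v.1 * a ≤ (T * v.2 + δ * a) * a := mul_le_mul_of_nonneg_right (by linarith) hm.le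
    have h4 : (T * v.2 + δ * a) * a = Real.exp (-H) * (v.2 * b) + δ * (a * a) := by
      linear_combination v.2 * hTa
    linarith

end

section

variable {Γ : Subgroup SL(2, ℝ)} {K : ℕ} {g : Fin K → SL(2, ℝ)} {R R' : Fin K → Set (ℝ × ℝ)}

/-! ### Hit sets and the Liouville measure -/

theorem countable_of_discreteTopology [DiscreteTopology Γ] : Countable Γ :=
  TopologicalSpace.separableSpace_iff_countable.1 inferInstance

theorem measurable_row_mul (a : SL(2, ℝ)) : Measurable fun x : SL(2, ℝ) => row (a * x) :=
  (continuous_row.comp (continuous_const_mul a)).measurable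

theorem hitSet_eq_iUnion :
    hitSet Γ g R = ⋃ κ, ⋃ γ : Γ, (fun x => row (g κ * γ * x)) ⁻¹' R κ := by
  ext x; simp [hitSet]

theorem measurableSet_hitSet [DiscreteTopology Γ] (hR : ∀ κ, MeasurableSet (R κ)) :
    MeasurableSet (hitSet Γ g R) := by
  have : Countable Γ := countable_of_discreteTopology
  rw [hitSet_eq_iUnion]
  exact MeasurableSet.iUnion fun κ => MeasurableSet.iUnion fun γ => measurable_row_mul _ (hR κ)

theorem haar_row_mul_preimage_null (a : SL(2, ℝ)) {N : Set (ℝ × ℝ)} (hN : volume N = 0) :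
    (Measure.haar : Measure SL(2, ℝ)) ((fun x => row (a * x)) ⁻¹' N) = 0 := by
  have : (fun x => row (a * x)) ⁻¹' N = (fun x => a * x) ⁻¹' (row ⁻¹' N) := rfl
  rw [this, measure_preimage_mul, haar_row_preimage_null hN]

theorem haar_hitSet_null [DiscreteTopology Γ] (hR : ∀ κ, volume (R κ) = 0) :
    (Measure.haar : Measure SL(2, ℝ)) (hitSet Γ g R) = 0 := by
  have : Countable Γ := countable_of_discreteTopology
  rw [hitSet_eq_iUnion]
  exact measure_iUnion_null fun κ => measure_iUnion_null fun γ =>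
    haar_row_mul_preimage_null _ (hR κ)

theorem continuous_rowMap (v : ℝ × ℝ) : Continuous fun x : SL(2, ℝ) => rowMap x v := by
  have := continuous_entry
  unfold rowMap
  fun_prop

theorem isOpenQuotientMap_mk : IsOpenQuotientMap (UnitTangent.mk Γ) :=
  MulAction.isOpenQuotientMap_quotientMk (Γ := Γ) (T := SL(2, ℝ))

theorem finite_orbit_of_bounded [DiscreteTopology Γ] (hg : IsCuspScaling Γ g) (x : SL(2, ℝ))
    (C : ℝ) : {p : Fin K × (ℝ × ℝ) | (∃ γ : Γ, row (g p.1 * γ * x) = p.2) ∧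
      |p.2.1| ≤ C ∧ |p.2.2| ≤ C}.Finite := by
  have hfin : (⋃ κ, (fun v => (κ, rowMap x v)) '' {v : ℝ × ℝ | (∃ γ : Γ, row (g κ * γ) = v) ∧
      ∃ y ∈ ({x} : Set SL(2, ℝ)), |(rowMap y v).1| ≤ C ∧ |(rowMap y v).2| ≤ C}).Finite :=
    Set.finite_iUnion fun κ => (finite_row_orbit_of_isCompact hg κ isCompact_singleton C).image _
  refine hfin.subset ?_
  rintro ⟨κ, v⟩ ⟨⟨γ, hγ⟩, h1, h2⟩
  have hv : rowMap x (row (g κ * γ)) = v := by rw [← row_mul]; exact hγ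
  exact Set.mem_iUnion.2 ⟨κ, row (g κ * γ), ⟨⟨γ, rfl⟩, x, rfl, by rwa [hv], by rwa [hv]⟩,
    by simp only [hv]⟩

/-- For bounded regions the hit set is a locally finite union of preimages, and closure commutes
with such unions. -/
theorem closure_hitSet_subset [DiscreteTopology Γ] (hg : IsCuspScaling Γ g)
    (hb : ∃ C : ℝ, ∀ κ, ∀ v ∈ R κ, |v.1| ≤ C ∧ |v.2| ≤ C) :
    closure (hitSet Γ g R) ⊆ hitSet Γ g fun κ => closure (R κ) := by
  obtain ⟨C, hC⟩ := hb
  -- The union is indexed by vectors rather than by `γ`: the cusp stabiliser gives infinitely many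
  -- `γ` with the same bottom row, which would destroy local finiteness.
  let f : {p : Fin K × (ℝ × ℝ) // ∃ γ : Γ, row (g p.1 * γ) = p.2} → Set SL(2, ℝ) :=
    fun p => (fun x => rowMap x p.1.2) ⁻¹' R p.1.1
  have hf : hitSet Γ g R = ⋃ p, f p := by
    ext x
    simp only [hitSet, Set.mem_ofPred_eq, Set.mem_iUnion, f, Set.mem_preimage]
    constructor
    · rintro ⟨κ, γ, h⟩
      exact ⟨⟨(κ, _), γ, rfl⟩, by rwa [← row_mul]⟩
    · rintro ⟨⟨⟨κ, v⟩, γ, hγ⟩, h⟩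
      exact ⟨κ, γ, by rw [row_mul]; exact hγ ▸ h⟩
  have hlf : LocallyFinite f := by
    intro x
    obtain ⟨N, hN, hxN⟩ := exists_compact_mem_nhds x
    refine ⟨N, hxN, ?_⟩
    have hfin : (⋃ κ, (fun v => (κ, v)) '' {v : ℝ × ℝ | (∃ γ : Γ, row (g κ * γ) = v) ∧
        ∃ x ∈ N, |(rowMap x v).1| ≤ C ∧ |(rowMap x v).2| ≤ C}).Finite :=
      Set.finite_iUnion fun κ => (finite_row_orbit_of_isCompact hg κ hN C).image _
    refine (hfin.preimage Subtype.val_injective.injOn).subset ?_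
    rintro ⟨⟨κ, v⟩, hp⟩ ⟨y, hy, hyN⟩
    exact Set.mem_iUnion.2 ⟨κ, v, ⟨hp, y, hyN, hC κ _ hy⟩, rfl⟩
  intro x hxc
  rw [hf, hlf.closure_iUnion, Set.mem_iUnion] at hxc
  obtain ⟨⟨⟨κ, v⟩, γ, hγ⟩, hxp⟩ := hxc
  have hv : v = row (g κ * γ) := hγ.symm
  subst hv
  refine ⟨κ, γ, ?_⟩
  rw [row_mul]
  exact (continuous_rowMap (row (g κ * γ))).closure_preimage_subset (R κ) hxp

theorem frontier_hitSet_subset [DiscreteTopology Γ] (hg : IsCuspScaling Γ g)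
    (hb : ∃ C : ℝ, ∀ κ, ∀ v ∈ R κ, |v.1| ≤ C ∧ |v.2| ≤ C) :
    frontier (hitSet Γ g R) ⊆ hitSet Γ g fun κ => frontier (R κ) := by
  intro x hx
  obtain ⟨κ, γ, hκ⟩ := closure_hitSet_subset hg hb hx.1
  refine ⟨κ, γ, hκ, fun hint => hx.2 ?_⟩
  rw [row_mul] at hint
  refine interior_maximal ?_ (isOpen_interior.preimage (continuous_rowMap (row (g κ * γ)))) hint
  intro y hy
  exact ⟨κ, γ, by rw [row_mul]; exact interior_subset hy⟩

theorem isClosed_hitQuot [DiscreteTopology Γ] (hg : IsCuspScaling Γ g)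
    (hb : ∃ C : ℝ, ∀ κ, ∀ v ∈ R κ, |v.1| ≤ C ∧ |v.2| ≤ C) (hR : ∀ κ, IsClosed (R κ)) :
    IsClosed (hitQuot Γ g R) := by
  rw [← isOpenQuotientMap_mk.isQuotientMap.isClosed_preimage, mk_preimage_hitQuot]
  refine isClosed_of_closure_subset ((closure_hitSet_subset hg hb).trans ?_)
  simp only [fun κ => (hR κ).closure_eq, subset_rfl]

/-- The σ-algebra on `𝒳` is the Borel one, so measurability is descended through closed sets: each
open `U κ` is a countable union of closed sets, and closed bounded regions have closed hit sets in
the quotient. -/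
theorem measurableSet_hitQuot [DiscreteTopology Γ] (hg : IsCuspScaling Γ g)
    {U : Fin K → Set (ℝ × ℝ)} (hb : ∃ C : ℝ, ∀ κ, ∀ v ∈ U κ ∩ R κ, |v.1| ≤ C ∧ |v.2| ≤ C)
    (hU : ∀ κ, IsOpen (U κ)) (hR : ∀ κ, IsClosed (R κ)) :
    MeasurableSet (hitQuot Γ g fun κ => U κ ∩ R κ) := by
  choose A hAc hAU hA _ using fun κ => (hU κ).exists_iUnion_isClosed
  obtain ⟨C, hC⟩ := hb
  have hunion : hitQuot Γ g (fun κ => U κ ∩ R κ) =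
      ⋃ n, hitQuot Γ g (fun κ => A κ n ∩ R κ) := by
    refine Set.Subset.antisymm ?_
      (Set.iUnion_subset fun n => hitQuot_mono fun κ => Set.inter_subset_inter_left _ (hAU κ n))
    rintro _ ⟨x, ⟨κ, γ, hx⟩, rfl⟩
    beta_reduce at hx
    rw [← hA κ] at hx
    obtain ⟨n, hn⟩ := Set.mem_iUnion.1 hx.1
    exact Set.mem_iUnion.2 ⟨n, x, ⟨κ, γ, hn, hx.2⟩, rfl⟩
  rw [hunion]
  exact MeasurableSet.iUnion fun n => (isClosed_hitQuot hg
    ⟨C, fun κ v hv => hC κ v ⟨hAU κ n hv.1, hv.2⟩⟩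
    fun κ => (hAc κ n).inter (hR κ)).measurableSet

theorem liouville_apply {F : Set SL(2, ℝ)} {E : Set (UnitTangent Γ)} (hE : MeasurableSet E) :
    liouville Γ F E = (Measure.haar F)⁻¹ * Measure.haar (UnitTangent.mk Γ ⁻¹' E ∩ F) := by
  have hm : Measurable (UnitTangent.mk Γ) := isOpenQuotientMap_mk.continuous.measurable
  rw [liouville, Measure.smul_apply, smul_eq_mul, Measure.map_apply hm hE,
    Measure.restrict_apply (hm hE)]

theorem liouville_frontier_hitQuot [DiscreteTopology Γ] (hg : IsCuspScaling Γ g)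
    (F : Set SL(2, ℝ)) (hb : ∃ C : ℝ, ∀ κ, ∀ v ∈ R κ, |v.1| ≤ C ∧ |v.2| ≤ C)
    (h0 : ∀ κ, volume (frontier (R κ)) = 0) :
    liouville Γ F (frontier (hitQuot Γ g R)) = 0 := by
  rw [liouville_apply isClosed_frontier.measurableSet,
    isOpenQuotientMap_mk.isOpenMap.preimage_frontier_eq_frontier_preimage
      isOpenQuotientMap_mk.continuous, mk_preimage_hitQuot]
  rw [measure_mono_null (Set.inter_subset_left.trans (frontier_hitSet_subset hg hb))
    (haar_hitSet_null h0), mul_zero]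

/-- A right translate of a fundamental domain for the left action is again a fundamental domain, and
a `Γ`-invariant set has the same measure in both. This is invariance of the Liouville measure under
right translation. -/
theorem invariant_measure_inter_mul {F : Set SL(2, ℝ)} [DiscreteTopology Γ]
    (hF : IsFundamentalDomain Γ F Measure.haar) {A : Set SL(2, ℝ)} (hA : MeasurableSet A)
    (hinv : ∀ (γ : Γ) (x : SL(2, ℝ)), (γ : SL(2, ℝ)) * x ∈ A ↔ x ∈ A) (h : SL(2, ℝ)) :
    (Measure.haar : Measure SL(2, ℝ)) ((fun x => x * h) ⁻¹' A ∩ F) = Measure.haar (A ∩ F) := by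
  have : Countable Γ := countable_of_discreteTopology
  have hF' : IsFundamentalDomain Γ ((fun x => x * h⁻¹) ⁻¹' F) (Measure.haar : Measure SL(2, ℝ)) :=
    hF.preimage_of_equiv (measurePreserving_mul_right _ h⁻¹).quasiMeasurePreserving
      (e := id) Function.bijective_id fun γ x => by
        simp [Subgroup.smul_def, mul_assoc]
  have hset : (fun x => x * h) ⁻¹' A ∩ F =
      (fun x => x * h) ⁻¹' (A ∩ (fun x => x * h⁻¹) ⁻¹' F) := by
    ext x; simp
  rw [hset, measure_preimage_mul_right]
  exact hF'.measure_set_eq hF hA fun γ => Set.ext fun x => hinv γ x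

/-! ### Almost every orbit hits the section -/

/-- The vectors which correspond to hitting the section in the direction `ε` of time. -/
def quadrantStrip (σ : Fin K → ℝ) (ε : ℝ) (κ : Fin K) : Set (ℝ × ℝ) :=
  {v | 0 < v.2 ∧ v.2 ≤ Real.exp (-(σ κ / 2)) ∧ 0 < ε * v.1}

/-- An increasing family of regions which exhausts the upper half-plane. -/
def growingStrip (σ : Fin K → ℝ) (ε : ℝ) (j : ℕ) (κ : Fin K) : Set (ℝ × ℝ) :=
  {v | 0 < v.2 ∧ v.2 ≤ Real.exp (-(σ κ / 2)) * Real.exp j ∧ 0 < ε * v.1 + j * v.2}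

theorem growingStrip_mono (σ : Fin K → ℝ) (ε : ℝ) (κ : Fin K) :
    Monotone fun j => growingStrip σ ε j κ := by
  intro i j hij v hv
  have hij' : (i : ℝ) ≤ j := by exact_mod_cast hij
  refine ⟨hv.1, hv.2.1.trans ?_, hv.2.2.trans_le ?_⟩
  · gcongr
  · have := hv.1.le
    gcongr

/-- Shearing tilts the boundary line of the strip and the geodesic matrix raises its top edge. Being
preimages under right multiplications, all these strips give hit sets of equal measure modulo `Γ`.
-/
theorem growingStrip_eq_preimage (σ : Fin K → ℝ) {ε : ℝ} (hε : ε * ε = 1) (j : ℕ) (κ : Fin K) :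
    growingStrip σ ε j κ =
      rowMap (unstableMatrix (-(ε * j)) * geodesicMatrix (2 * j)) ⁻¹' quadrantStrip σ ε κ := by
  ext v
  have hmul : rowMap (unstableMatrix (-(ε * j)) * geodesicMatrix (2 * j)) v =
      rowMap (geodesicMatrix (2 * j)) (rowMap (unstableMatrix (-(ε * j))) v) := by
    ext <;> simp [rowMap, mul_entry]
    ring
  have h2 : (2 * (j : ℝ)) / 2 = j := by ring
  simp only [Set.mem_preimage, hmul, rowMap_unstableMatrix, rowMap_geodesicMatrix, growingStrip,
    quadrantStrip, Set.mem_ofPred_eq, h2]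
  refine and_congr ?_ (and_congr ?_ ?_)
  · rw [mul_pos_iff_of_pos_right (Real.exp_pos _)]
  · rw [Real.exp_neg (j : ℝ), ← div_eq_mul_inv, div_le_iff₀ (Real.exp_pos _)]
  · rw [← mul_assoc, mul_pos_iff_of_pos_right (Real.exp_pos _)]
    have : ε * (v.1 - -(ε * j) * v.2) = ε * v.1 + j * v.2 := by
      linear_combination (j : ℝ) * v.2 * hε
    rw [this]

theorem measurableSet_quadrantStrip (σ : Fin K → ℝ) (ε : ℝ) (κ : Fin K) :
    MeasurableSet (quadrantStrip σ ε κ) :=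
  (measurableSet_lt measurable_const measurable_snd).inter
    ((measurableSet_le measurable_snd measurable_const).inter
      (measurableSet_lt measurable_const (measurable_fst.const_mul ε)))

theorem exists_mem_growingStrip (σ : Fin K → ℝ) (ε : ℝ) (κ : Fin K) {v : ℝ × ℝ} (hv : 0 < v.2) :
    ∃ j : ℕ, v ∈ growingStrip σ ε j κ := by
  have hδ := Real.exp_pos (-(σ κ / 2))
  obtain ⟨j, hj⟩ := exists_nat_gt (max (v.2 / Real.exp (-(σ κ / 2))) (-(ε * v.1) / v.2))
  rw [max_lt_iff, div_lt_iff₀ hδ, div_lt_iff₀ hv] at hj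
  refine ⟨j, hv, ?_, by linarith [hj.2]⟩
  have : (j : ℝ) ≤ Real.exp j := by linarith [Real.add_one_le_exp (j : ℝ)]
  nlinarith [hj.1]

/-- The complements of the hit sets of the growing strips decrease, yet all have the same finite
measure in `F`. Their intersection is null, so that common measure is zero. -/
theorem ae_mem_hitSet_quadrantStrip [DiscreteTopology Γ] (hneg : (-1 : SL(2, ℝ)) ∈ Γ)
    {F : Set SL(2, ℝ)} (hF : IsFundamentalDomain Γ F Measure.haar)
    (hFfin : Measure.haar F ≠ ∞) (hK : 0 < K) (g : Fin K → SL(2, ℝ)) (σ : Fin K → ℝ)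
    {ε : ℝ} (hε : ε * ε = 1) :
    ∀ᵐ x ∂(Measure.haar : Measure SL(2, ℝ)), x ∈ hitSet Γ g (quadrantStrip σ ε) := by
  have : Countable Γ := countable_of_discreteTopology
  let N : ℕ → Set SL(2, ℝ) := fun j => (hitSet Γ g (growingStrip σ ε j))ᶜ
  have hNpre : ∀ j, N j = (fun x => x * (unstableMatrix (-(ε * j)) * geodesicMatrix (2 * j))) ⁻¹'
      (hitSet Γ g (quadrantStrip σ ε))ᶜ := by
    intro j
    ext x
    simp only [N, Set.mem_preimage, Set.mem_compl_iff, mul_mem_hitSet]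
    rw [show growingStrip σ ε j = _ from funext fun κ => growingStrip_eq_preimage σ hε j κ]
  have hmeas : MeasurableSet (hitSet Γ g (quadrantStrip σ ε))ᶜ :=
    (measurableSet_hitSet (measurableSet_quadrantStrip σ ε)).compl
  have hconst : ∀ j, (Measure.haar : Measure SL(2, ℝ)) (N j ∩ F) =
      Measure.haar ((hitSet Γ g (quadrantStrip σ ε))ᶜ ∩ F) := fun j => by
    rw [hNpre]
    exact invariant_measure_inter_mul hF hmeas (fun γ x => not_congr (coe_mul_mem_hitSet γ)) _
  have hNm : ∀ j, MeasurableSet (N j) := fun j => by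
    rw [hNpre]; exact measurable_mul_const _ hmeas
  have hlim : Tendsto (fun j => (Measure.haar : Measure SL(2, ℝ)) (N j ∩ F)) atTop
      (𝓝 (Measure.haar (⋂ j, N j ∩ F))) := by
    refine tendsto_measure_iInter_atTop
      (fun j => (hNm j).nullMeasurableSet.inter hF.nullMeasurableSet) ?_
      ⟨0, ne_top_of_le_ne_top hFfin (measure_mono Set.inter_subset_right)⟩
    intro i j hij
    exact Set.inter_subset_inter_left _
      (Set.compl_subset_compl.2 (hitSet_mono fun κ => growingStrip_mono σ ε κ hij))
  have hzero : (Measure.haar : Measure SL(2, ℝ)) (⋂ j, N j ∩ F) = 0 := by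
    have hnull : volume {v : ℝ × ℝ | v.2 = 0} = 0 := by
      simpa [ae_iff] using ae_snd_ne_zero
    refine measure_mono_null ?_ (haar_row_mul_preimage_null (g ⟨0, hK⟩) hnull)
    intro x hx
    have hno : ∀ γ : Γ, ¬ 0 < (row (g ⟨0, hK⟩ * γ * x)).2 := fun γ hpos => by
      obtain ⟨j, hj⟩ := exists_mem_growingStrip σ ε ⟨0, hK⟩ hpos
      exact (Set.mem_iInter.1 hx j).1 ⟨_, γ, hj⟩
    -- Neither `γ = 1` nor `γ = -1` gives a positive second coordinate, so this coordinate of `row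
    -- (g κ * x)` vanishes, which is a null condition.
    have h1 := hno 1
    have h2 := hno ⟨-1, hneg⟩
    simp only [row, Subgroup.coe_one, mul_one, mul_neg, neg_mul,
      Matrix.SpecialLinearGroup.coe_neg, Matrix.neg_apply] at h1 h2
    change (g ⟨0, hK⟩ * x) 1 1 = 0
    linarith
  have hF0 : (Measure.haar : Measure SL(2, ℝ)) ((hitSet Γ g (quadrantStrip σ ε))ᶜ ∩ F) = 0 := by
    rw [hzero] at hlim
    simp only [hconst] at hlim
    exact tendsto_nhds_unique tendsto_const_nhds hlim
  rw [ae_iff]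
  refine hF.measure_zero_of_invariant _ (fun γ => ?_) hF0
  ext x
  rw [Set.mem_smul_set_iff_inv_smul_mem]
  exact not_congr (coe_mul_mem_hitSet γ⁻¹)

end

section

variable {Γ : Subgroup SL(2, ℝ)} {K : ℕ} {g : Fin K → SL(2, ℝ)} {σ : Fin K → ℝ} {ε : ℝ}

/-! ### First hitting times -/

/-- The first hitting time of the section in the direction `ε` of time, in terms of orbit
vectors. -/
def firstHit (Γ : Subgroup SL(2, ℝ)) (g : Fin K → SL(2, ℝ)) (σ : Fin K → ℝ) (ε : ℝ)
    (x : SL(2, ℝ)) : ℝ≥0∞ :=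
  ⨅ κ, ⨅ γ : Γ, ⨅ _ : row (g κ * γ * x) ∈ quadrantStrip σ ε κ,
    ENNReal.ofReal (ε * (row (g κ * γ * x)).1 / (row (g κ * γ * x)).2)

theorem le_firstHit_iff {x : SL(2, ℝ)} {a : ℝ≥0∞} :
    a ≤ firstHit Γ g σ ε x ↔ ∀ κ, ∀ γ : Γ, row (g κ * γ * x) ∈ quadrantStrip σ ε κ →
      a ≤ ENNReal.ofReal (ε * (row (g κ * γ * x)).1 / (row (g κ * γ * x)).2) := by
  simp only [firstHit, le_iInf_iff]

theorem firstHit_le {x : SL(2, ℝ)} {κ : Fin K} {γ : Γ}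
    (h : row (g κ * γ * x) ∈ quadrantStrip σ ε κ) : firstHit Γ g σ ε x ≤
      ENNReal.ofReal (ε * (row (g κ * γ * x)).1 / (row (g κ * γ * x)).2) :=
  le_firstHit_iff.1 le_rfl κ γ h

theorem measurable_firstHit [DiscreteTopology Γ] : Measurable (firstHit Γ g σ ε) := by
  have : Countable Γ := countable_of_discreteTopology
  refine Measurable.iInf fun κ => Measurable.iInf fun γ => ?_
  classical
  simp only [iInf_eq_if]
  have h := measurable_row_mul (g κ * γ)
  exact Measurable.ite (h (measurableSet_quadrantStrip σ ε κ))
    ((((measurable_fst.comp h).const_mul ε).div (measurable_snd.comp h)).ennreal_ofReal)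
    measurable_const

theorem firstHit_coe_mul (γ : Γ) (x : SL(2, ℝ)) :
    firstHit Γ g σ ε (γ * x) = firstHit Γ g σ ε x := by
  refine eq_of_forall_le_iff fun a => ?_
  simp only [le_firstHit_iff]
  refine forall_congr' fun κ => ⟨fun h δ => ?_, fun h δ => ?_⟩
  · have := h (δ * γ⁻¹)
    simpa [mul_assoc] using this
  · have := h (δ * γ)
    simpa [mul_assoc] using this

theorem iInf_hitting_eq_firstHit (hε : ε * ε = 1) (x : SL(2, ℝ)) :
    ⨅ r ∈ {r : ℝ | 0 < r ∧ unstableFlow (ε * r) (UnitTangent.mk Γ x) ∈ multiSection Γ g σ 0},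
      ENNReal.ofReal r = firstHit Γ g σ ε x := by
  refine eq_of_forall_le_iff fun a => ?_
  simp only [le_firstHit_iff, le_iInf_iff, Set.mem_ofPred_eq, unstableFlow_mk_mem_multiSection]
  constructor
  · intro h κ γ hv
    refine h _ ⟨div_pos hv.2.2 hv.1, κ, γ, ?_, hv.1, hv.2.1⟩
    have := hv.1.ne'
    field_simp
    linear_combination -(row (g κ * γ * x)).1 * hε
  · rintro h r ⟨hr, κ, γ, h1, h2, h3⟩
    have he : ε * (row (g κ * γ * x)).1 = r * (row (g κ * γ * x)).2 := by
      rw [h1]; linear_combination r * (row (g κ * γ * x)).2 * hε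
    have := h κ γ ⟨h2, h3, by rw [he]; exact mul_pos hr h2⟩
    rwa [he, mul_div_cancel_right₀ _ h2.ne'] at this

theorem returnTime_eq_firstHit (w : ℝ × ℝ × Fin K) :
    returnTime Γ g σ w = firstHit Γ g σ 1 ((g w.2.2)⁻¹ * flowBox w.1 w.2.1 0) := by
  rw [← iInf_hitting_eq_firstHit (by norm_num), returnTime, sectionMap_eq_mk, mul_assoc,
    stable_mul_geodesic]
  simp only [one_mul]
  rfl

theorem backwardReturnTime_eq_firstHit (w : ℝ × ℝ × Fin K) :
    backwardReturnTime Γ g σ w = firstHit Γ g σ (-1) ((g w.2.2)⁻¹ * flowBox w.1 w.2.1 0) := by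
  rw [← iInf_hitting_eq_firstHit (by norm_num), backwardReturnTime, sectionMap_eq_mk, mul_assoc,
    stable_mul_geodesic]
  simp only [neg_mul, one_mul]

/-- The infimum is attained: vectors in the strip with hitting time at most that of one known hit
are bounded, hence finite in number. -/
theorem exists_eq_firstHit [DiscreteTopology Γ] (hg : IsCuspScaling Γ g) (hε : ε * ε = 1)
    {x : SL(2, ℝ)} (hx : x ∈ hitSet Γ g (quadrantStrip σ ε)) :
    ∃ κ, ∃ γ : Γ, row (g κ * γ * x) ∈ quadrantStrip σ ε κ ∧
      ENNReal.ofReal (ε * (row (g κ * γ * x)).1 / (row (g κ * γ * x)).2) =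
        firstHit Γ g σ ε x := by
  obtain ⟨κ₀, γ₀, h₀⟩ := hx
  set r₀ := ε * (row (g κ₀ * γ₀ * x)).1 / (row (g κ₀ * γ₀ * x)).2 with hr₀
  have hr₀pos : 0 < r₀ := div_pos h₀.2.2 h₀.1
  let A : Set (Fin K × (ℝ × ℝ)) := {p | (∃ γ : Γ, row (g p.1 * γ * x) = p.2) ∧
    p.2 ∈ quadrantStrip σ ε p.1 ∧ ε * p.2.1 / p.2.2 ≤ r₀}
  have habs : |ε| = 1 := by
    rcases mul_self_eq_one_iff.1 hε with h | h <;> simp [h]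
  have hA : A.Finite := by
    refine (finite_orbit_of_bounded hg x
      (max 1 r₀ * ∑ κ, Real.exp (-(σ κ / 2)))).subset ?_
    rintro ⟨κ, v⟩ ⟨hγ, ⟨h1, h2, h3⟩, h4⟩
    simp only at hγ h1 h2 h3 h4
    have h2' : v.2 ≤ ∑ κ, Real.exp (-(σ κ / 2)) :=
      h2.trans (Finset.single_le_sum (f := fun κ => Real.exp (-(σ κ / 2)))
        (fun _ _ => (Real.exp_pos _).le) (Finset.mem_univ κ))
    rw [div_le_iff₀ h1] at h4
    refine ⟨hγ, ?_, ?_⟩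
    · calc |v.1| = |ε * v.1| := by rw [abs_mul, habs, one_mul]
        _ = ε * v.1 := abs_of_pos h3
        _ ≤ r₀ * v.2 := h4
        _ ≤ max 1 r₀ * ∑ κ, Real.exp (-(σ κ / 2)) :=
          mul_le_mul (le_max_right _ _) h2' h1.le (by positivity)
    · calc |v.2| = 1 * v.2 := by rw [abs_of_pos h1, one_mul]
        _ ≤ max 1 r₀ * ∑ κ, Real.exp (-(σ κ / 2)) :=
          mul_le_mul (le_max_left _ _) h2' h1.le (by positivity)
  obtain ⟨⟨κ, v⟩, ⟨⟨γ, hγ⟩, hv, hle⟩, hmin⟩ := Set.exists_min_image A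
    (fun p => ε * p.2.1 / p.2.2) hA ⟨(κ₀, _), ⟨γ₀, rfl⟩, h₀, le_rfl⟩
  simp only at hγ hv hle hmin
  subst hγ
  refine ⟨κ, γ, hv, le_antisymm (le_firstHit_iff.2 fun κ' γ' hv' => ENNReal.ofReal_le_ofReal ?_)
    (firstHit_le hv)⟩
  rcases le_total (ε * (row (g κ' * γ' * x)).1 / (row (g κ' * γ' * x)).2) r₀ with h | h
  · exact hmin (κ', _) ⟨⟨γ', rfl⟩, hv', h⟩
  · exact hle.trans h

/-- Flowing back for time `r` from a point of the section, the section is first hit after time `r`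
if and only if there is no earlier backward return. -/
theorem ofReal_eq_firstHit_iff (hε : ε * ε = 1) {z : SL(2, ℝ)} {r : ℝ} (hr : 0 < r)
    (hz : ∃ κ, ∃ γ : Γ, (row (g κ * γ * z)).1 = 0 ∧ 0 < (row (g κ * γ * z)).2 ∧
      (row (g κ * γ * z)).2 ≤ Real.exp (-(σ κ / 2))) :
    ENNReal.ofReal r = firstHit Γ g σ ε (z * unstableMatrix (-(ε * r))) ↔
      ENNReal.ofReal r ≤ firstHit Γ g σ (-ε) z := by
  have hrow : ∀ κ (γ : Γ), row (g κ * γ * (z * unstableMatrix (-(ε * r)))) =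
      ((row (g κ * γ * z)).1 + ε * r * (row (g κ * γ * z)).2, (row (g κ * γ * z)).2) := by
    intro κ γ
    rw [← mul_assoc, row_mul, rowMap_unstableMatrix]
    ext <;> simp
  have hval : ∀ v : ℝ × ℝ, ε * (v.1 + ε * r * v.2) = ε * v.1 + r * v.2 := fun v => by
    linear_combination r * v.2 * hε
  have hle : firstHit Γ g σ ε (z * unstableMatrix (-(ε * r))) ≤ ENNReal.ofReal r := by
    obtain ⟨κ, γ, h1, h2, h3⟩ := hz
    have hmem : row (g κ * γ * (z * unstableMatrix (-(ε * r)))) ∈ quadrantStrip σ ε κ := by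
      rw [hrow]
      refine ⟨h2, h3, ?_⟩
      simp only
      rw [hval, h1]
      simpa using mul_pos hr h2
    refine (firstHit_le hmem).trans (le_of_eq ?_)
    rw [hrow]
    simp only
    rw [hval, h1, mul_zero, zero_add, mul_div_cancel_right₀ _ h2.ne']
  -- The starting section point itself gives a hit at time `r`, so only earlier hits matter. A
  -- vector `v` at `z` has hitting time `r + ε v.1 / v.2` at the shifted point; this lies in `(0,
  -- r)` exactly when `-ε v.1 / v.2` does.
  rw [(hle.ge_iff_eq').symm]
  simp only [le_firstHit_iff, hrow]
  refine forall_congr' fun κ => forall_congr' fun γ => ?_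
  set v := row (g κ * γ * z)
  simp only [quadrantStrip, Set.mem_ofPred_eq, hval]
  constructor
  · rintro h ⟨h1, h2, h3⟩
    by_contra hcon
    rw [not_le, ENNReal.ofReal_lt_ofReal_iff hr, div_lt_iff₀ h1] at hcon
    have := h ⟨h1, h2, by linarith⟩
    rw [ENNReal.ofReal_le_ofReal_iff (div_nonneg (by linarith) h1.le), le_div_iff₀ h1] at this
    linarith
  · rintro h ⟨h1, h2, h3⟩
    refine ENNReal.ofReal_le_ofReal ?_
    rw [le_div_iff₀ h1]
    by_contra hcon
    have := h ⟨h1, h2, by linarith⟩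
    rw [ENNReal.ofReal_le_ofReal_iff (div_nonneg (by linarith) h1.le), le_div_iff₀ h1] at this
    linarith

/-! ### A fundamental domain made of flow boxes -/

/-- The points whose first hit, in the direction `ε` of time, is at the cusp `κ`, in reduced
position. -/
def hitDomain (Γ : Subgroup SL(2, ℝ)) (g : Fin K → SL(2, ℝ)) (σ : Fin K → ℝ) (ε : ℝ)
    (κ : Fin K) : Set SL(2, ℝ) :=
  {x | row (g κ * x) ∈ quadrantStrip σ ε κ ∧ (g κ * x) 0 1 / (g κ * x) 1 1 ∈ Set.Ico (0 : ℝ) 1 ∧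
    ENNReal.ofReal (ε * (row (g κ * x)).1 / (row (g κ * x)).2) = firstHit Γ g σ ε x}

theorem measurableSet_hitDomain [DiscreteTopology Γ] (κ : Fin K) :
    MeasurableSet (hitDomain Γ g σ ε κ) := by
  have h := measurable_row_mul (g κ)
  have he : ∀ i j, Measurable fun x : SL(2, ℝ) => (g κ * x) i j := fun i j =>
    (measurable_entry i j).comp (measurable_const_mul (g κ))
  exact (h (measurableSet_quadrantStrip σ ε κ)).inter
    ((((he 0 1).div (he 1 1)) measurableSet_Ico).inter (measurableSet_eq_fun
      (((measurable_fst.comp h).const_mul ε).div (measurable_snd.comp h)).ennreal_ofReal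
      measurable_firstHit))

/-- The first hitting time is `Γ`-invariant, so the two bottom rows have the same slope and are
proportional. The transition matrix therefore fixes `∞` and is an integer translation, which the
reduction to `[0, 1)` forces to be trivial. -/
theorem hitDomain_unique (hg : IsCuspScaling Γ g) (hε : ε * ε = 1) {κ ℓ : Fin K} {γ : Γ}
    {x : SL(2, ℝ)} (hx : x ∈ hitDomain Γ g σ ε κ) (hγx : (γ : SL(2, ℝ)) * x ∈ hitDomain Γ g σ ε ℓ) :
    κ = ℓ ∧ γ = 1 := by
  obtain ⟨⟨a1, a2, a3⟩, a4, a5⟩ := hx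
  obtain ⟨⟨b1, b2, b3⟩, b4, b5⟩ := hγx
  rw [firstHit_coe_mul, ← a5] at b5
  set A := g κ * x with hA
  set B := g ℓ * (γ * x) with hB
  simp only [row] at a1 a2 a3 a5 b1 b2 b3 b5
  have hdet := det_entries A
  have hcross : B 1 0 * A 1 1 = B 1 1 * A 1 0 := by
    rw [ENNReal.ofReal_eq_ofReal_iff (div_pos b3 b1).le (div_pos a3 a1).le,
      div_eq_div_iff b1.ne' a1.ne'] at b5
    linear_combination ε * b5 - (B 1 0 * A 1 1 - A 1 0 * B 1 1) * hε
  have hM : g ℓ * γ * (g κ)⁻¹ = B * A⁻¹ := by rw [hA, hB]; group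
  obtain ⟨i1, i2, i3, i4⟩ := inv_entries A
  obtain ⟨rfl, m, hm⟩ := eq_of_lower_left_eq_zero (ℓ := ℓ) hg γ
    (by rw [hM, mul_entry, i1, i3]; linarith)
    (by
      rw [hM, mul_entry, i2, i4]
      refine pos_of_mul_pos_left (b := A 1 1) ?_ a1.le
      have : (B 1 0 * -A 0 1 + B 1 1 * A 0 0) * A 1 1 = B 1 1 := by
        linear_combination B 1 1 * hdet - A 0 1 * hcross
      rw [this]; exact b1)
  refine ⟨rfl, ?_⟩
  have hBA : B = stableMatrix m * A := by rw [← hm, hM]; group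
  have e11 : B 1 1 = A 1 1 := by rw [hBA]; simp [mul_entry]
  have e01 : B 0 1 / B 1 1 = A 0 1 / A 1 1 + m := by
    rw [e11, hBA, mul_entry]
    simp only [stableMatrix_zero_zero, stableMatrix_zero_one]
    field_simp
  have hm0 : m = 0 := by
    rw [e01] at b4
    have h1 : (m : ℝ) < 1 := by linarith [b4.2, a4.1]
    have h2 : (-1 : ℝ) < m := by linarith [b4.1, a4.2]
    have h1' : m < 1 := by exact_mod_cast h1
    have h2' : -1 < m := by exact_mod_cast h2
    omega
  have hs0 : stableMatrix ((0 : ℤ) : ℝ) = 1 := by refine sl_ext ?_ ?_ ?_ ?_ <;> simp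
  rw [hm0, hs0, mul_inv_eq_one, mul_eq_left] at hm
  exact Subtype.ext hm

/-- Covering comes from the almost sure existence of a first hit, reduced by the cusp stabiliser;
disjointness of translates is `hitDomain_unique`. -/
theorem isFundamentalDomain_hitDomain [DiscreteTopology Γ] (hneg : (-1 : SL(2, ℝ)) ∈ Γ)
    {F : Set SL(2, ℝ)} (hF : IsFundamentalDomain Γ F Measure.haar)
    (hFfin : Measure.haar F ≠ ∞) (hK : 0 < K) (hg : IsCuspScaling Γ g) (σ : Fin K → ℝ)
    (hε : ε * ε = 1) :
    IsFundamentalDomain Γ (⋃ κ, hitDomain Γ g σ ε κ) (Measure.haar : Measure SL(2, ℝ)) := by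
  refine IsFundamentalDomain.mk''
    (MeasurableSet.iUnion fun κ => measurableSet_hitDomain κ).nullMeasurableSet ?_ ?_
    fun γ => (measurePreserving_smul γ _).quasiMeasurePreserving
  · filter_upwards [ae_mem_hitSet_quadrantStrip hneg hF hFfin hK g σ hε] with x hx
    obtain ⟨κ, γ, hQ, hfirst⟩ := exists_eq_firstHit hg hε hx
    obtain ⟨γ', hrow, hred⟩ := exists_reduced hg κ γ x hQ.1.ne'
    refine ⟨γ', Set.mem_iUnion.2 ⟨κ, ?_⟩⟩
    change (γ' : SL(2, ℝ)) * x ∈ _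
    rw [← hrow] at hQ hfirst
    simp only [hitDomain, Set.mem_ofPred_eq, ← mul_assoc, firstHit_coe_mul]
    exact ⟨hQ, hred, hfirst⟩
  · intro γ hγ
    refine Disjoint.aedisjoint (Set.disjoint_left.2 fun y hy hy' => hγ ?_)
    obtain ⟨x, hx, rfl⟩ := hy
    obtain ⟨κ, hκ⟩ := Set.mem_iUnion.1 hx
    obtain ⟨ℓ, hℓ⟩ := Set.mem_iUnion.1 hy'
    exact (hitDomain_unique hg hε hκ hℓ).2

theorem volume_pos_ofReal_le (b : ℝ≥0∞) : volume {r : ℝ | 0 < r ∧ ENNReal.ofReal r ≤ b} = b := by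
  induction b with
  | top =>
    have : {r : ℝ | 0 < r ∧ ENNReal.ofReal r ≤ ∞} = Set.Ioi 0 := by ext; simp
    rw [this, Real.volume_Ioi]
  | coe b =>
    have : {r : ℝ | 0 < r ∧ ENNReal.ofReal r ≤ b} = Set.Ioc 0 (b : ℝ) := by
      ext r
      simp only [Set.mem_ofPred_eq, Set.mem_Ioc]
      refine and_congr_right fun hr => ?_
      rw [← ENNReal.ofReal_coe_nnreal, ENNReal.ofReal_le_ofReal_iff b.coe_nonneg]
    rw [this, Real.volume_Ioc, sub_zero, ENNReal.ofReal_coe_nnreal]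

theorem flowBox_eq_mul (s t r : ℝ) : flowBox s t r = flowBox s t 0 * unstableMatrix (-r) := by
  rw [← stable_mul_geodesic, flowBox]

/-- Exhibits the domain as the region under the graph of the return time in direction `-ε`, over the
section parameters. -/
theorem flowBox_mem_hitDomain_iff (hε : ε * ε = 1) (κ : Fin K) (s t r : ℝ) :
    (g κ)⁻¹ * flowBox s t (ε * r) ∈ hitDomain Γ g σ ε κ ↔
      s ∈ Set.Ico (0 : ℝ) 1 ∧ t ∈ Set.Ici (σ κ) ∧ 0 < r ∧
        ENNReal.ofReal r ≤ firstHit Γ g σ (-ε) ((g κ)⁻¹ * flowBox s t 0) := by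
  have hexp := Real.exp_pos (-(t / 2))
  have hval : ε * (ε * r * Real.exp (-(t / 2))) = r * Real.exp (-(t / 2)) := by
    linear_combination r * Real.exp (-(t / 2)) * hε
  simp only [hitDomain, Set.mem_ofPred_eq, mul_inv_cancel_left, row, flowBox_one_zero,
    flowBox_one_one, flowBox_zero_one, quadrantStrip, hval, mul_div_cancel_right₀ _ hexp.ne',
    hexp, true_and, Real.exp_le_exp, mul_pos_iff_of_pos_right hexp]
  have hcond : ∀ (_ : 0 < r) (_ : σ κ ≤ t),
      (ENNReal.ofReal r = firstHit Γ g σ ε ((g κ)⁻¹ * flowBox s t (ε * r)) ↔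
        ENNReal.ofReal r ≤ firstHit Γ g σ (-ε) ((g κ)⁻¹ * flowBox s t 0)) := by
    intro hr ht
    rw [flowBox_eq_mul s t (ε * r), ← mul_assoc]
    refine ofReal_eq_firstHit_iff hε hr ⟨κ, 1, ?_⟩
    simp only [Subgroup.coe_one, mul_one, mul_inv_cancel_left, row, flowBox_one_zero,
      flowBox_one_one, zero_mul, true_and, hexp, Real.exp_le_exp]
    linarith
  constructor
  · rintro ⟨⟨h1, h2⟩, h3, h4⟩
    have ht : σ κ ≤ t := by linarith
    exact ⟨h3, ht, h2, (hcond h2 ht).1 h4⟩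
  · rintro ⟨h1, h2, h3, h4⟩
    have h2' : σ κ ≤ t := h2
    exact ⟨⟨by linarith, h3⟩, h1, (hcond h3 h2).2 h4⟩

theorem lintegral_comp_sign (hε : ε * ε = 1) (f : ℝ → ℝ≥0∞) :
    ∫⁻ r, f (ε * r) = ∫⁻ r, f r := by
  rcases mul_self_eq_one_iff.1 hε with rfl | rfl
  · simp
  · simpa using lintegral_neg_eq_self f

theorem firstHit_eq_of_mem_hitDomain (hε : ε * ε = 1) {κ : Fin K} {s t r : ℝ}
    (h : (g κ)⁻¹ * flowBox s t (ε * r) ∈ hitDomain Γ g σ ε κ) :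
    firstHit Γ g σ ε ((g κ)⁻¹ * flowBox s t (ε * r)) = ENNReal.ofReal r := by
  have hexp := Real.exp_pos (-(t / 2))
  have hval : ε * (ε * r * Real.exp (-(t / 2))) = r * Real.exp (-(t / 2)) := by
    linear_combination r * Real.exp (-(t / 2)) * hε
  have := h.2.2
  simp only [mul_inv_cancel_left, row, flowBox_one_zero,
    flowBox_one_one, hval, mul_div_cancel_right₀ _ hexp.ne'] at this
  exact this.symm

/-- The Haar measure of the part of the fundamental domain where the first hitting time is at most
`a`. -/
theorem haar_hitDomain [DiscreteTopology Γ] {c : ℝ≥0∞}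
    (hc : ∀ f : SL(2, ℝ) → ℝ≥0∞, Measurable f →
      ∫⁻ x in {x | 0 < x 1 1}, f x ∂Measure.haar =
        c * ∫⁻ s, ∫⁻ t, ∫⁻ r, f (flowBox s t r) * ENNReal.ofReal (Real.exp (-t)))
    (hε : ε * ε = 1) (κ : Fin K) (a : ℝ≥0∞) :
    (Measure.haar : Measure SL(2, ℝ)) ({x | firstHit Γ g σ ε x ≤ a} ∩ hitDomain Γ g σ ε κ) =
      c * ∫⁻ s in Set.Ico (0 : ℝ) 1, ∫⁻ t in Set.Ici (σ κ),
        min a (firstHit Γ g σ (-ε) ((g κ)⁻¹ * flowBox s t 0)) *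
          ENNReal.ofReal (Real.exp (-t)) := by
  set E := {x | firstHit Γ g σ ε x ≤ a} ∩ hitDomain Γ g σ ε κ with hE
  have hEm : MeasurableSet E :=
    (measurableSet_le measurable_firstHit measurable_const).inter (measurableSet_hitDomain κ)
  set E' := (fun y => (g κ)⁻¹ * y) ⁻¹' E with hE'
  have hEm' : MeasurableSet E' := measurable_const_mul _ hEm
  have hsub : E' ⊆ {x : SL(2, ℝ) | 0 < x 1 1} := by
    intro y hy
    have := hy.2.1.1
    simpa [row] using this
  -- Left translation by `g κ` preserves Haar measure and moves the domain into the half where the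
  -- lower right entry is positive, so the flow-box formula applies.
  have hmeas : (Measure.haar : Measure SL(2, ℝ)) E =
      ∫⁻ x in {x | 0 < x 1 1}, E'.indicator 1 x ∂Measure.haar := by
    rw [lintegral_indicator_one hEm', Measure.restrict_apply hEm', Set.inter_eq_left.2 hsub, hE',
      measure_preimage_mul]
  rw [hmeas, hc _ (measurable_one.indicator hEm')]
  congr 1
  rw [← lintegral_indicator measurableSet_Ico]
  refine lintegral_congr fun s => ?_
  by_cases hs : s ∈ Set.Ico (0 : ℝ) 1
  swap
  · rw [Set.indicator_of_notMem hs]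
    have hzero : ∀ t r, E'.indicator (1 : SL(2, ℝ) → ℝ≥0∞) (flowBox s t r) = 0 := by
      intro t r
      refine Set.indicator_of_notMem (fun hmem => hs ?_) _
      have hmem' : (g κ)⁻¹ * flowBox s t (ε * (ε * r)) ∈ hitDomain Γ g σ ε κ := by
        rw [← mul_assoc, hε, one_mul]; exact hmem.2
      exact ((flowBox_mem_hitDomain_iff hε κ s t _).1 hmem').1
    simp [hzero]
  rw [Set.indicator_of_mem hs, ← lintegral_indicator measurableSet_Ici]
  refine lintegral_congr fun t => ?_
  -- After replacing `r` by `ε r` the variable is the hitting time itself, and the fibre is an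
  -- interval from `0` whose length is the minimum in the statement.
  rw [lintegral_mul_const' _ _ ENNReal.ofReal_ne_top, ← lintegral_comp_sign hε]
  have hiff : ∀ r, flowBox s t (ε * r) ∈ E' ↔ t ∈ Set.Ici (σ κ) ∧
      (0 < r ∧ ENNReal.ofReal r ≤ min a (firstHit Γ g σ (-ε) ((g κ)⁻¹ * flowBox s t 0))) := by
    intro r
    have hdom := flowBox_mem_hitDomain_iff (Γ := Γ) (g := g) (σ := σ) hε κ s t r
    constructor
    · rintro ⟨h1, h2⟩
      obtain ⟨-, h3, h4, h5⟩ := hdom.1 h2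
      have h1' : firstHit Γ g σ ε ((g κ)⁻¹ * flowBox s t (ε * r)) ≤ a := h1
      rw [firstHit_eq_of_mem_hitDomain hε h2] at h1'
      exact ⟨h3, h4, le_min h1' h5⟩
    · rintro ⟨h3, h4, h5⟩
      have h2 := hdom.2 ⟨hs, h3, h4, h5.trans (min_le_right _ _)⟩
      refine ⟨?_, h2⟩
      change firstHit Γ g σ ε ((g κ)⁻¹ * flowBox s t (ε * r)) ≤ a
      rw [firstHit_eq_of_mem_hitDomain hε h2]
      exact h5.trans (min_le_left _ _)
  by_cases ht : t ∈ Set.Ici (σ κ)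
  · rw [Set.indicator_of_mem ht]
    congr 1
    have hset : (fun r => E'.indicator (1 : SL(2, ℝ) → ℝ≥0∞) (flowBox s t (ε * r))) =
        Set.indicator {r : ℝ | 0 < r ∧ ENNReal.ofReal r ≤
          min a (firstHit Γ g σ (-ε) ((g κ)⁻¹ * flowBox s t 0))} 1 := by
      ext r
      simp only [Set.indicator, hiff, ht, true_and, Set.mem_ofPred_eq, Pi.one_apply]
    rw [hset, lintegral_indicator_one, volume_pos_ofReal_le]
    exact (measurableSet_lt measurable_const measurable_id).inter
      (measurableSet_le ENNReal.measurable_ofReal measurable_const)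
  · rw [Set.indicator_of_notMem ht]
    have hzero : ∀ r, E'.indicator (1 : SL(2, ℝ) → ℝ≥0∞) (flowBox s t (ε * r)) = 0 := fun r =>
      Set.indicator_of_notMem (fun hmem => ht ((hiff r).1 hmem).1) _
    simp [hzero]

theorem haar_iUnion_hitDomain [DiscreteTopology Γ] (hg : IsCuspScaling Γ g) {c : ℝ≥0∞}
    (hc : ∀ f : SL(2, ℝ) → ℝ≥0∞, Measurable f →
      ∫⁻ x in {x | 0 < x 1 1}, f x ∂Measure.haar =
        c * ∫⁻ s, ∫⁻ t, ∫⁻ r, f (flowBox s t r) * ENNReal.ofReal (Real.exp (-t)))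
    (hε : ε * ε = 1) (a : ℝ≥0∞) :
    (Measure.haar : Measure SL(2, ℝ))
        ({x | firstHit Γ g σ ε x ≤ a} ∩ ⋃ κ, hitDomain Γ g σ ε κ) =
      c * sectionIntegral σ fun w =>
        min a (firstHit Γ g σ (-ε) ((g w.2.2)⁻¹ * flowBox w.1 w.2.1 0)) := by
  rw [Set.inter_iUnion, measure_iUnion, tsum_fintype, sectionIntegral, Finset.mul_sum]
  · exact Finset.sum_congr rfl fun κ _ => haar_hitDomain hc hε κ a
  · intro κ ℓ hne
    refine Set.disjoint_left.2 fun x hx hx' => hne ?_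
    exact (hitDomain_unique (γ := 1) hg hε hx.2 (by simpa using hx'.2)).1
  · exact fun κ => (measurableSet_le measurable_firstHit measurable_const).inter
      (measurableSet_hitDomain κ)

end

section

variable {Γ : Subgroup SL(2, ℝ)} {K : ℕ} {g : Fin K → SL(2, ℝ)} {σ : Fin K → ℝ}

/-! ### The regions of the plane which describe the extreme value events -/

theorem isLinearMap_fst : IsLinearMap ℝ (Prod.fst : ℝ × ℝ → ℝ) := ⟨fun _ _ => rfl, fun _ _ => rfl⟩

theorem isLinearMap_snd : IsLinearMap ℝ (Prod.snd : ℝ × ℝ → ℝ) := ⟨fun _ _ => rfl, fun _ _ => rfl⟩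

theorem isLinearMap_fst_sub (m : ℝ) : IsLinearMap ℝ fun v : ℝ × ℝ => v.1 - m * v.2 :=
  ⟨fun v w => by simp; ring, fun a v => by simp; ring⟩

theorem extremeRegion_eq (σ : Fin K → ℝ) (H : ℝ) : extremeRegion σ H = fun κ =>
    ({v | 0 < v.2} ∩ {v | v.2 < Real.exp (-(σ κ / 2))} ∩ {v | 0 < v.1}) ∩
      {v : ℝ × ℝ | v.1 - Real.exp (-H) * v.2 ≤ 0} := by
  ext κ v
  simp [extremeRegion, and_assoc]

theorem thickRegion_eq (σ : Fin K → ℝ) (H ε : ℝ) (κ : Fin K) : thickRegion σ H ε κ =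
    {v | 0 ≤ v.2} ∩ {v | v.2 ≤ Real.exp (-(σ κ / 2))} ∩ {v | -ε ≤ v.1} ∩
      {v : ℝ × ℝ | v.1 - Real.exp (-H) * v.2 ≤ ε} := by
  ext v
  simp [thickRegion, and_assoc, add_comm]

theorem volume_frontier_extremeRegion (σ : Fin K → ℝ) (H : ℝ) (κ : Fin K) :
    volume (frontier (extremeRegion σ H κ)) = 0 := by
  refine Convex.addHaar_frontier _ ?_
  rw [extremeRegion_eq]
  exact (((convex_halfSpace_gt isLinearMap_snd _).inter
    (convex_halfSpace_lt isLinearMap_snd _)).inter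
    (convex_halfSpace_gt isLinearMap_fst _)).inter (convex_halfSpace_le (isLinearMap_fst_sub _) _)

theorem volume_frontier_thickRegion (σ : Fin K → ℝ) (H ε : ℝ) (κ : Fin K) :
    volume (frontier (thickRegion σ H ε κ)) = 0 := by
  refine Convex.addHaar_frontier _ ?_
  rw [thickRegion_eq]
  exact (((convex_halfSpace_ge isLinearMap_snd _).inter
    (convex_halfSpace_le isLinearMap_snd _)).inter
    (convex_halfSpace_ge isLinearMap_fst _)).inter (convex_halfSpace_le (isLinearMap_fst_sub _) _)

theorem isClosed_thickRegion (σ : Fin K → ℝ) (H ε : ℝ) (κ : Fin K) :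
    IsClosed (thickRegion σ H ε κ) := by
  rw [thickRegion_eq]
  exact (((isClosed_le continuous_const continuous_snd).inter
    (isClosed_le continuous_snd continuous_const)).inter
    (isClosed_le continuous_const continuous_fst)).inter
    (isClosed_le (by fun_prop) continuous_const)

theorem thickRegion_bounded (σ : Fin K → ℝ) (H ε : ℝ) :
    ∃ C : ℝ, ∀ κ, ∀ v ∈ thickRegion σ H ε κ, |v.1| ≤ C ∧ |v.2| ≤ C := by
  refine ⟨(1 + Real.exp (-H)) * (∑ κ, Real.exp (-(σ κ / 2))) + |ε|, fun κ v hv => ?_⟩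
  obtain ⟨h1, h2, h3, h4⟩ := hv
  have hS : Real.exp (-(σ κ / 2)) ≤ ∑ κ, Real.exp (-(σ κ / 2)) :=
    Finset.single_le_sum (f := fun κ => Real.exp (-(σ κ / 2))) (fun _ _ => (Real.exp_pos _).le)
      (Finset.mem_univ κ)
  have hS0 : 0 ≤ ∑ κ, Real.exp (-(σ κ / 2)) := (Real.exp_pos _).le.trans hS
  have hH := Real.exp_pos (-H)
  have hv2 : v.2 ≤ ∑ κ, Real.exp (-(σ κ / 2)) := h2.trans hS
  have hp1 := mul_le_mul_of_nonneg_left hv2 hH.le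
  have hp2 := mul_nonneg hH.le hS0
  have hε := le_abs_self ε
  have hε0 := abs_nonneg ε
  constructor
  · rw [abs_le]; constructor <;> nlinarith
  · rw [abs_le]; constructor <;> nlinarith

theorem extremeRegion_subset_thickRegion (σ : Fin K → ℝ) (H : ℝ) (κ : Fin K) :
    extremeRegion σ H κ ⊆ thickRegion σ H 0 κ := fun _ ⟨h1, h2, h3, h4⟩ =>
  ⟨h1.le, h2.le, by simpa using h3.le, by simpa using h4⟩

theorem extremeRegion_bounded (σ : Fin K → ℝ) (H : ℝ) :
    ∃ C : ℝ, ∀ κ, ∀ v ∈ extremeRegion σ H κ, |v.1| ≤ C ∧ |v.2| ≤ C := by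
  obtain ⟨C, hC⟩ := thickRegion_bounded σ H 0
  exact ⟨C, fun κ v hv => hC κ v (extremeRegion_subset_thickRegion σ H κ hv)⟩

theorem measurableSet_hitQuot_extremeRegion [DiscreteTopology Γ] (hg : IsCuspScaling Γ g)
    (σ : Fin K → ℝ) (H : ℝ) : MeasurableSet (hitQuot Γ g (extremeRegion σ H)) := by
  have hb := extremeRegion_bounded σ H
  rw [extremeRegion_eq] at hb ⊢
  exact measurableSet_hitQuot hg hb
    (fun κ => ((isOpen_lt continuous_const continuous_snd).inter
      (isOpen_lt continuous_snd continuous_const)).inter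
      (isOpen_lt continuous_const continuous_fst))
    fun κ => isClosed_le (by fun_prop) continuous_const

theorem measurableSet_hitQuot_thickRegion [DiscreteTopology Γ] (hg : IsCuspScaling Γ g)
    (σ : Fin K → ℝ) (H ε : ℝ) : MeasurableSet (hitQuot Γ g (thickRegion σ H ε)) :=
  (isClosed_hitQuot hg (thickRegion_bounded σ H ε) (isClosed_thickRegion σ H ε)).measurableSet

/-- At thickness zero the two regions share the slanted edge and differ only along the bottom, top
and left edges, which lie on three lines. -/
theorem volume_thickRegion_diff (σ : Fin K → ℝ) (H : ℝ) (κ : Fin K) :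
    volume (thickRegion σ H 0 κ \ extremeRegion σ H κ) = 0 := by
  have hline1 : ∀ a : ℝ, volume (Set.univ ×ˢ {a} : Set (ℝ × ℝ)) = 0 := fun a => by
    rw [Measure.volume_eq_prod, Measure.prod_prod]; simp
  have hline2 : ∀ a : ℝ, volume ({a} ×ˢ Set.univ : Set (ℝ × ℝ)) = 0 := fun a => by
    rw [Measure.volume_eq_prod, Measure.prod_prod]; simp
  refine measure_mono_null ?_ (measure_union_null (measure_union_null (hline1 0)
    (hline1 (Real.exp (-(σ κ / 2))))) (hline2 0))
  rintro v ⟨⟨h1, h2, h3, h4⟩, hn⟩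
  by_contra hcon
  simp only [Set.mem_union, Set.mem_prod, Set.mem_univ, Set.mem_singleton_iff, true_and, and_true,
    not_or] at hcon
  obtain ⟨⟨c1, c2⟩, c3⟩ := hcon
  exact hn ⟨lt_of_le_of_ne h1 (Ne.symm c1), lt_of_le_of_ne h2 c2,
    lt_of_le_of_ne (by simpa using h3) (Ne.symm c3), by simpa using h4⟩

theorem haar_hitSet_inter_congr [DiscreteTopology Γ] {R R' : Fin K → Set (ℝ × ℝ)}
    (hR : ∀ κ, R κ ⊆ R' κ) (h0 : ∀ κ, volume (R' κ \ R κ) = 0) (F : Set SL(2, ℝ)) :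
    (Measure.haar : Measure SL(2, ℝ)) (hitSet Γ g R ∩ F) = Measure.haar (hitSet Γ g R' ∩ F) := by
  refine le_antisymm (measure_mono (Set.inter_subset_inter_left _ (hitSet_mono hR))) ?_
  have hsub : hitSet Γ g R' ∩ F ⊆ (hitSet Γ g R ∩ F) ∪ hitSet Γ g fun κ => R' κ \ R κ := by
    rintro x ⟨⟨κ, γ, hx⟩, hF⟩
    by_cases h : row (g κ * γ * x) ∈ R κ
    · exact Or.inl ⟨⟨κ, γ, h⟩, hF⟩
    · exact Or.inr ⟨κ, γ, hx, h⟩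
  refine (measure_mono hsub).trans ((measure_union_le _ _).trans ?_)
  rw [haar_hitSet_null h0, add_zero]

/-! ### The measure of the limiting event -/

theorem hitSet_eq_firstHit_le [DiscreteTopology Γ] (hg : IsCuspScaling Γ g) (H : ℝ) :
    hitSet Γ g (fun κ => {v | 0 < v.2 ∧ v.2 ≤ Real.exp (-(σ κ / 2)) ∧ 0 < v.1 ∧
      v.1 ≤ Real.exp (-H) * v.2}) =
    {x | firstHit Γ g σ 1 x ≤ ENNReal.ofReal (Real.exp (-H))} := by
  ext x
  constructor
  · rintro ⟨κ, γ, h1, h2, h3, h4⟩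
    refine (firstHit_le ⟨h1, h2, by simpa using h3⟩).trans (ENNReal.ofReal_le_ofReal ?_)
    rw [one_mul, div_le_iff₀ h1]
    exact h4
  · intro hx
    have hx' : firstHit Γ g σ 1 x ≤ ENNReal.ofReal (Real.exp (-H)) := hx
    have hmem : x ∈ hitSet Γ g (quadrantStrip σ 1) := by
      by_contra hcon
      have htop : ⊤ ≤ firstHit Γ g σ 1 x :=
        le_firstHit_iff.2 fun κ γ h => (hcon ⟨κ, γ, h⟩).elim
      exact ENNReal.ofReal_ne_top (top_le_iff.1 (htop.trans hx'))
    obtain ⟨κ, γ, ⟨h1, h2, h3⟩, heq⟩ := exists_eq_firstHit hg (by norm_num) hmem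
    rw [← heq, one_mul, ENNReal.ofReal_le_ofReal_iff (Real.exp_pos _).le, div_le_iff₀ h1] at hx'
    exact ⟨κ, γ, h1, h2, by simpa using h3, hx'⟩

theorem haar_fundamentalDomain_ne_zero [DiscreteTopology Γ] {F : Set SL(2, ℝ)}
    (hF : IsFundamentalDomain Γ F Measure.haar) : (Measure.haar : Measure SL(2, ℝ)) F ≠ 0 := by
  have : Countable Γ := countable_of_discreteTopology
  exact hF.measure_ne_zero (NeZero.ne _)

/-- The same constant `c` occurs throughout because one flow-box formula is used for both time
directions. Sorting by backward hits yields the forward return time, and conversely; comparing the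
two fundamental domains with `F` equates the two means. -/
theorem haar_eq_sectionIntegral [DiscreteTopology Γ] (hneg : (-1 : SL(2, ℝ)) ∈ Γ)
    {F : Set SL(2, ℝ)} (hF : IsFundamentalDomain Γ F Measure.haar)
    (hFfin : Measure.haar F ≠ ∞) (hK : 0 < K) (hg : IsCuspScaling Γ g) (σ : Fin K → ℝ) :
    ∃ c : ℝ≥0∞, c ≠ 0 ∧ c ≠ ∞ ∧ Measure.haar F = c * meanReturnTime Γ g σ ∧
      Measure.haar F = c * sectionIntegral σ (backwardReturnTime Γ g σ) ∧
      ∀ H : ℝ, Measure.haar (hitSet Γ g (extremeRegion σ H) ∩ F) =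
        c * sectionIntegral σ fun w =>
          min (ENNReal.ofReal (Real.exp (-H))) (backwardReturnTime Γ g σ w) := by
  have : Countable Γ := countable_of_discreteTopology
  obtain ⟨c, hc0, hct, hc⟩ := exists_haar_flowBox
  have h1 : (1 : ℝ) * 1 = 1 := by norm_num
  have h2 : (-1 : ℝ) * (-1) = 1 := by norm_num
  have hD1 := isFundamentalDomain_hitDomain hneg hF hFfin hK hg σ h1
  have hD2 := isFundamentalDomain_hitDomain hneg hF hFfin hK hg σ h2
  have e1 := haar_iUnion_hitDomain (Γ := Γ) (σ := σ) hg hc h1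
  have e2 := haar_iUnion_hitDomain (Γ := Γ) (σ := σ) hg hc h2
  refine ⟨c, hc0, hct, ?_, ?_, fun H => ?_⟩
  · have := e2 ∞
    simp only [le_top, Set.ofPred_true, Set.univ_inter, min_eq_right, neg_neg] at this
    rw [hF.measure_eq hD2, this, meanReturnTime]
    congr 2
    ext w
    rw [returnTime_eq_firstHit]
  · have := e1 ∞
    simp only [le_top, Set.ofPred_true, Set.univ_inter, min_eq_right] at this
    rw [hF.measure_eq hD1, this]
    congr 2
    ext w
    rw [backwardReturnTime_eq_firstHit]
  -- The event uses strict height, whereas first hits use the section including its boundary `t =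
  -- σ_κ`; the top edge that separates them is null.
  · have hnull : ∀ κ, volume ({v : ℝ × ℝ | 0 < v.2 ∧ v.2 ≤ Real.exp (-(σ κ / 2)) ∧ 0 < v.1 ∧
        v.1 ≤ Real.exp (-H) * v.2} \ extremeRegion σ H κ) = 0 := fun κ => by
      refine measure_mono_null (Set.sdiff_subset_sdiff_left ?_) (volume_thickRegion_diff σ H κ)
      rintro v ⟨h1, h2, h3, h4⟩
      exact ⟨h1.le, h2, by simpa using h3.le, by simpa using h4⟩
    have hsub : ∀ κ, extremeRegion σ H κ ⊆ {v : ℝ × ℝ | 0 < v.2 ∧ v.2 ≤ Real.exp (-(σ κ / 2)) ∧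
        0 < v.1 ∧ v.1 ≤ Real.exp (-H) * v.2} := fun κ v hv => ⟨hv.1, hv.2.1.le, hv.2.2⟩
    rw [haar_hitSet_inter_congr hsub hnull,
      hitSet_eq_firstHit_le hg, hF.measure_set_eq hD1
        (measurableSet_le measurable_firstHit measurable_const)
        (fun γ => Set.ext fun x => by
          change firstHit Γ g σ 1 ((γ : SL(2, ℝ)) * x) ≤ _ ↔ _
          rw [firstHit_coe_mul]; rfl), e1]
    congr 2
    ext w
    rw [backwardReturnTime_eq_firstHit]

end

section

variable {Γ : Subgroup SL(2, ℝ)} {K : ℕ} {g : Fin K → SL(2, ℝ)} {σ : Fin K → ℝ}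

/-! ### The limit density -/

theorem measurable_backwardReturnTime [DiscreteTopology Γ] (κ : Fin K) :
    Measurable fun p : ℝ × ℝ => backwardReturnTime Γ g σ (p.1, p.2, κ) := by
  have hp : Measurable fun p : ℝ × ℝ => (p.1, p.2, (0 : ℝ)) :=
    measurable_fst.prodMk (measurable_snd.prodMk measurable_const)
  have hflow : Measurable fun p : ℝ × ℝ => flowBox p.1 p.2 0 := by
    have h := measurable_flowBox.comp hp
    exact h
  have hmul : Measurable fun p : ℝ × ℝ => (g κ)⁻¹ * flowBox p.1 p.2 0 := hflow.const_mul _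
  have h := (measurable_firstHit (Γ := Γ) (g := g) (σ := σ) (ε := -1)).comp hmul
  simpa only [backwardReturnTime_eq_firstHit, Function.comp_def] using h

theorem sectionIntegral_const_mul {a : ℝ≥0∞} (ha : a ≠ ∞) (f : ℝ × ℝ × Fin K → ℝ≥0∞) :
    sectionIntegral σ (fun w => a * f w) = a * sectionIntegral σ f := by
  simp only [sectionIntegral, Finset.mul_sum, mul_assoc, lintegral_const_mul' _ _ ha]

theorem sectionIntegral_mono {f f' : ℝ × ℝ × Fin K → ℝ≥0∞} (h : ∀ w, f w ≤ f' w) :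
    sectionIntegral σ f ≤ sectionIntegral σ f' :=
  Finset.sum_le_sum fun _ _ => lintegral_mono fun _ => lintegral_mono fun _ =>
    mul_le_mul_left (h _) _

theorem sectionIntegral_one_ne_top : sectionIntegral σ (fun _ => 1) ≠ ∞ := by
  refine ENNReal.sum_ne_top.2 fun κ _ => ?_
  have hint : ∫⁻ t in Set.Ici (σ κ), 1 * ENNReal.ofReal (Real.exp (-t)) < ∞ := by
    simp only [one_mul]
    exact ((integrableOn_Ici_iff_integrableOn_Ioi).2
      (integrableOn_exp_neg_Ioi (σ κ))).lintegral_lt_top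
  rw [setLIntegral_const, Real.volume_Ico]
  exact ENNReal.mul_ne_top hint.ne (by simp)

open Classical in
/-- The indicator of `{η > r}`, with `η` the backward return time. -/
def survival (Γ : Subgroup SL(2, ℝ)) (g : Fin K → SL(2, ℝ)) (σ : Fin K → ℝ) (r : ℝ)
    (w : ℝ × ℝ × Fin K) : ℝ≥0∞ :=
  if ENNReal.ofReal r < backwardReturnTime Γ g σ w then 1 else 0

theorem measurable_survival [DiscreteTopology Γ] (κ : Fin K) :
    Measurable fun p : ℝ × ℝ × ℝ => survival Γ g σ p.1 (p.2.1, p.2.2, κ) := by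
  classical
  unfold survival
  refine Measurable.ite (measurableSet_lt (by fun_prop) ?_) measurable_const measurable_const
  exact (measurable_backwardReturnTime κ).comp measurable_snd

theorem measurable_survival_mul [DiscreteTopology Γ] (κ : Fin K) :
    Measurable fun q : (ℝ × ℝ) × ℝ =>
      survival Γ g σ q.1.1 (q.1.2, q.2, κ) * ENNReal.ofReal (Real.exp (-q.2)) := by
  have hp : Measurable fun q : (ℝ × ℝ) × ℝ => (q.1.1, q.1.2, q.2) :=
    (measurable_fst.comp measurable_fst).prodMk
      ((measurable_snd.comp measurable_fst).prodMk measurable_snd)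
  have h : Measurable fun q : (ℝ × ℝ) × ℝ => survival Γ g σ q.1.1 (q.1.2, q.2, κ) := by
    have h := (measurable_survival (Γ := Γ) (g := g) (σ := σ) κ).comp hp
    exact h
  exact h.mul (by fun_prop)

theorem measurable_lintegral_survival [DiscreteTopology Γ] (κ : Fin K) :
    Measurable fun q : ℝ × ℝ => ∫⁻ t in Set.Ici (σ κ),
      survival Γ g σ q.1 (q.2, t, κ) * ENNReal.ofReal (Real.exp (-t)) :=
  (measurable_survival_mul κ).lintegral_prod_right'

theorem measurable_sectionIntegral_survival [DiscreteTopology Γ] :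
    Measurable fun r => sectionIntegral σ (survival Γ g σ r) :=
  Finset.measurable_sum _ fun κ _ => (measurable_lintegral_survival κ).lintegral_prod_right'

theorem volume_pos_ofReal_lt (b : ℝ≥0∞) : volume {r : ℝ | 0 < r ∧ ENNReal.ofReal r < b} = b := by
  induction b with
  | top =>
    have : {r : ℝ | 0 < r ∧ ENNReal.ofReal r < ∞} = Set.Ioi 0 := by ext; simp
    rw [this, Real.volume_Ioi]
  | coe b =>
    have : {r : ℝ | 0 < r ∧ ENNReal.ofReal r < b} = Set.Ioo 0 (b : ℝ) := by
      ext r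
      simp only [Set.mem_ofPred_eq, Set.mem_Ioo]
      refine and_congr_right fun hr => ?_
      rw [← ENNReal.ofReal_coe_nnreal, ENNReal.ofReal_lt_ofReal_iff_of_nonneg hr.le]
    rw [this, Real.volume_Ioo, sub_zero, ENNReal.ofReal_coe_nnreal]

theorem measurableSet_pos_ofReal_lt (b : ℝ≥0∞) :
    MeasurableSet {r : ℝ | 0 < r ∧ ENNReal.ofReal r < b} :=
  (measurableSet_lt measurable_const measurable_id).inter
    (measurableSet_lt ENNReal.measurable_ofReal measurable_const)

/-- The layer-cake identity `∫_0^b 1(r < η) dr = min(b, η)`, with `b = ∞` allowed for the total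
mass. -/
theorem lintegral_survival (b : ℝ≥0∞) (w : ℝ × ℝ × Fin K) :
    ∫⁻ r in {r : ℝ | 0 < r ∧ ENNReal.ofReal r < b}, survival Γ g σ r w =
      min b (backwardReturnTime Γ g σ w) := by
  have hset : (Set.indicator {r : ℝ | 0 < r ∧ ENNReal.ofReal r < b} fun r => survival Γ g σ r w) =
      Set.indicator {r : ℝ | 0 < r ∧ ENNReal.ofReal r < min b (backwardReturnTime Γ g σ w)} 1 := by
    ext r
    by_cases h1 : 0 < r <;> by_cases h2 : ENNReal.ofReal r < b <;>
      by_cases h3 : ENNReal.ofReal r < backwardReturnTime Γ g σ w <;>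
      simp [Set.indicator, survival, h1, h2, h3]
  rw [← lintegral_indicator (measurableSet_pos_ofReal_lt b), hset,
    lintegral_indicator_one (measurableSet_pos_ofReal_lt _), volume_pos_ofReal_lt]

theorem lintegral_sectionIntegral_survival [DiscreteTopology Γ] (b : ℝ≥0∞) :
    ∫⁻ r in {r : ℝ | 0 < r ∧ ENNReal.ofReal r < b}, sectionIntegral σ (survival Γ g σ r) =
      sectionIntegral σ fun w => min b (backwardReturnTime Γ g σ w) := by
  simp only [sectionIntegral]
  rw [lintegral_finsetSum _ fun κ _ => (measurable_lintegral_survival κ).lintegral_prod_right']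
  refine Finset.sum_congr rfl fun κ _ => ?_
  rw [lintegral_lintegral_swap (measurable_lintegral_survival κ).aemeasurable]
  refine lintegral_congr fun s => ?_
  have hp : Measurable fun q : ℝ × ℝ => ((q.1, s), q.2) :=
    (measurable_fst.prodMk measurable_const).prodMk measurable_snd
  have hm : Measurable fun q : ℝ × ℝ =>
      survival Γ g σ q.1 (s, q.2, κ) * ENNReal.ofReal (Real.exp (-q.2)) := by
    have h := (measurable_survival_mul (Γ := Γ) (g := g) (σ := σ) κ).comp hp
    exact h
  rw [lintegral_lintegral_swap hm.aemeasurable]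
  refine lintegral_congr fun t => ?_
  rw [lintegral_mul_const' _ _ ENNReal.ofReal_ne_top]
  dsimp only
  rw [lintegral_survival]

theorem sectionIntegral_jointDensity (hmean : meanReturnTime Γ g σ ≠ 0) (r : ℝ) :
    sectionIntegral σ (jointDensity Γ g σ r) =
      (meanReturnTime Γ g σ)⁻¹ * sectionIntegral σ (survival Γ g σ r) :=
  sectionIntegral_const_mul (ENNReal.inv_ne_top.2 hmean) (survival Γ g σ r)

theorem ofReal_hittingDensity (hmean : meanReturnTime Γ g σ ≠ 0) (r : ℝ) :
    ENNReal.ofReal (hittingDensity Γ g σ r) =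
      (meanReturnTime Γ g σ)⁻¹ * sectionIntegral σ (survival Γ g σ r) := by
  rw [hittingDensity, sectionIntegral_jointDensity hmean, ENNReal.ofReal_toReal]
  refine ENNReal.mul_ne_top (ENNReal.inv_ne_top.2 hmean)
    (ne_top_of_le_ne_top (sectionIntegral_one_ne_top (σ := σ)) (sectionIntegral_mono fun w => ?_))
  unfold survival
  split_ifs <;> simp

theorem extremeDensity_nonneg (s : ℝ) : 0 ≤ extremeDensity Γ g σ s :=
  mul_nonneg (Real.exp_pos _).le ENNReal.toReal_nonneg

theorem measurable_extremeDensity [DiscreteTopology Γ] (hmean : meanReturnTime Γ g σ ≠ 0) :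
    Measurable (extremeDensity Γ g σ) := by
  have h : Measurable (hittingDensity Γ g σ) := by
    unfold hittingDensity
    simp only [sectionIntegral_jointDensity hmean]
    exact (measurable_sectionIntegral_survival.const_mul _).ennreal_toReal
  unfold extremeDensity
  fun_prop

/-- The factor `e^{-s}` in the density is the Jacobian of `r = e^{-s}`. The parameter `b` covers
both the tail beyond `H`, with `b = e^{-H}`, and the whole line, with `b = ∞`. -/
theorem lintegral_extremeDensity [DiscreteTopology Γ] (hmean : meanReturnTime Γ g σ ≠ 0)
    {S : Set ℝ} (hS : MeasurableSet S) {b : ℝ≥0∞}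
    (himg : (fun s : ℝ => Real.exp (-s)) '' S = {r : ℝ | 0 < r ∧ ENNReal.ofReal r < b}) :
    ∫⁻ s in S, ENNReal.ofReal (extremeDensity Γ g σ s) =
      (meanReturnTime Γ g σ)⁻¹ *
        sectionIntegral σ fun w => min b (backwardReturnTime Γ g σ w) := by
  have h := lintegral_image_eq_lintegral_abs_deriv_mul (s := S)
    (f := fun s : ℝ => Real.exp (-s)) (f' := fun s => Real.exp (-s) * (-1)) hS
    (fun x _ => ((hasDerivAt_id x).neg.exp).hasDerivWithinAt)
    (fun a _ b _ hab => by simpa using hab)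
    (fun r => ENNReal.ofReal (hittingDensity Γ g σ r))
  rw [himg] at h
  calc ∫⁻ s in S, ENNReal.ofReal (extremeDensity Γ g σ s)
      = ∫⁻ s in S, ENNReal.ofReal |Real.exp (-s) * (-1)| *
          ENNReal.ofReal (hittingDensity Γ g σ (Real.exp (-s))) := by
        refine lintegral_congr fun s => ?_
        rw [← ENNReal.ofReal_mul (abs_nonneg _)]
        simp [extremeDensity]
    _ = ∫⁻ r in {r : ℝ | 0 < r ∧ ENNReal.ofReal r < b}, (meanReturnTime Γ g σ)⁻¹ *
          sectionIntegral σ (survival Γ g σ r) := by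
        rw [← h]
        simp only [ofReal_hittingDensity hmean]
    _ = _ := by
        rw [lintegral_const_mul' _ _ (ENNReal.inv_ne_top.2 hmean),
          lintegral_sectionIntegral_survival]

theorem image_exp_neg_Ioi (H : ℝ) : (fun s : ℝ => Real.exp (-s)) '' Set.Ioi H =
    {r : ℝ | 0 < r ∧ ENNReal.ofReal r < ENNReal.ofReal (Real.exp (-H))} := by
  ext r
  constructor
  · rintro ⟨s, hs, rfl⟩
    refine ⟨Real.exp_pos _, ?_⟩
    rw [ENNReal.ofReal_lt_ofReal_iff (Real.exp_pos _), Real.exp_lt_exp]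
    exact neg_lt_neg hs
  · rintro ⟨h1, h2⟩
    rw [ENNReal.ofReal_lt_ofReal_iff (Real.exp_pos _), ← Real.log_lt_iff_lt_exp h1] at h2
    exact ⟨-Real.log r, by rw [Set.mem_Ioi]; linarith, by simp [Real.exp_log h1]⟩

theorem image_exp_neg_univ : (fun s : ℝ => Real.exp (-s)) '' Set.univ =
    {r : ℝ | 0 < r ∧ ENNReal.ofReal r < ∞} := by
  ext r
  constructor
  · rintro ⟨s, -, rfl⟩
    exact ⟨Real.exp_pos _, ENNReal.ofReal_lt_top⟩
  · rintro ⟨h1, -⟩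
    exact ⟨-Real.log r, trivial, by simp [Real.exp_log h1]⟩

/-! ### Equidistribution of the extreme value events -/

theorem tendsto_geodesicFlow_hitQuot [DiscreteTopology Γ] (hg : IsCuspScaling Γ g)
    {F : Set SL(2, ℝ)} {lam : Measure (UnitTangent Γ)} (hlam : IsAdmissible (liouville Γ F) lam)
    [IsFiniteMeasure (liouville Γ F)]
    {R : Fin K → Set (ℝ × ℝ)} (hb : ∃ C : ℝ, ∀ κ, ∀ v ∈ R κ, |v.1| ≤ C ∧ |v.2| ≤ C)
    (h0 : ∀ κ, volume (frontier (R κ)) = 0) (hm : MeasurableSet (hitQuot Γ g R)) (H : ℝ) :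
    Tendsto (fun T : ℝ => lam.real (geodesicFlow (H + Real.log T) '' hitQuot Γ g R)) atTop
      (𝓝 ((liouville Γ F).real (hitQuot Γ g R))) :=
  (ENNReal.tendsto_toReal (measure_ne_top _ _)).comp
    ((hlam _ hm (liouville_frontier_hitQuot hg F hb h0)).comp
      (tendsto_atTop_add_const_left _ _ Real.tendsto_log_atTop))

/-! ### Shrinking the thick regions and squeezing the surface event -/

theorem thickRegion_mono (σ : Fin K → ℝ) (H : ℝ) (κ : Fin K) {ε ε' : ℝ} (h : ε ≤ ε') :
    thickRegion σ H ε κ ⊆ thickRegion σ H ε' κ := fun _ ⟨h1, h2, h3, h4⟩ =>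
  ⟨h1, h2, by linarith, by linarith⟩

theorem iInter_thickRegion (σ : Fin K → ℝ) (H : ℝ) (κ : Fin K) :
    ⋂ n : ℕ, thickRegion σ H (1 / (n + 1)) κ ⊆ thickRegion σ H 0 κ := by
  intro v hv
  rw [Set.mem_iInter] at hv
  have hlim : Tendsto (fun n : ℕ => (1 : ℝ) / (n + 1)) atTop (𝓝 0) :=
    tendsto_one_div_add_atTop_nhds_zero_nat
  refine ⟨(hv 0).1, (hv 0).2.1, ?_, ?_⟩
  · exact le_of_tendsto hlim.neg (Eventually.of_forall fun n => (hv n).2.2.1)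
  · exact ge_of_tendsto (hlim.const_add _) (Eventually.of_forall fun n => (hv n).2.2.2)

/-- The vector that witnesses a hit may vary with `n`, so a compactness argument is needed: the
witnesses form a decreasing sequence of nonempty finite sets and hence share an element. -/
theorem iInter_hitQuot_thickRegion [DiscreteTopology Γ] (hg : IsCuspScaling Γ g)
    (σ : Fin K → ℝ) (H : ℝ) :
    ⋂ n : ℕ, hitQuot Γ g (thickRegion σ H (1 / (n + 1))) = hitQuot Γ g (thickRegion σ H 0) := by
  refine Set.Subset.antisymm ?_ (Set.subset_iInter fun n => hitQuot_mono fun κ =>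
    thickRegion_mono σ H κ (by positivity))
  intro x₀ hx
  obtain ⟨x, rfl⟩ := mk_surjective x₀
  simp only [Set.mem_iInter, mk_mem_hitQuot] at hx
  rw [mk_mem_hitQuot]
  obtain ⟨C, hC⟩ := thickRegion_bounded σ H 1
  let A : ℕ → Set (Fin K × (ℝ × ℝ)) := fun n => {p | (∃ γ : Γ, row (g p.1 * γ * x) = p.2) ∧
    p.2 ∈ thickRegion σ H (1 / (n + 1)) p.1}
  have hle : ∀ n : ℕ, (1 : ℝ) / (n + 1) ≤ 1 := fun n => by
    rw [div_le_one (by positivity)]; linarith [n.cast_nonneg (α := ℝ)]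
  have hfin : ∀ n, (A n).Finite := fun n => (finite_orbit_of_bounded hg x C).subset
    fun p hp => ⟨hp.1, hC _ _ (thickRegion_mono σ H _ (hle n) hp.2)⟩
  have hne : (⋂ n, A n).Nonempty := by
    refine IsCompact.nonempty_iInter_of_sequence_nonempty_isCompact_isClosed A ?_ ?_
      (hfin 0).isCompact fun n => (hfin n).isClosed
    · intro n p hp
      refine ⟨hp.1, thickRegion_mono σ H _ ?_ hp.2⟩
      gcongr
      simp
    · intro n
      obtain ⟨κ, γ, h⟩ := hx n
      exact ⟨(κ, _), ⟨γ, rfl⟩, h⟩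
  obtain ⟨⟨κ, v⟩, hp⟩ := hne
  rw [Set.mem_iInter] at hp
  obtain ⟨γ, hγ⟩ := (hp 0).1
  refine ⟨κ, γ, iInter_thickRegion σ H κ (Set.mem_iInter.2 fun n => ?_)⟩
  have := (hp n).2
  rwa [← hγ] at this

theorem liouville_hitQuot_thickRegion_zero [DiscreteTopology Γ] (hg : IsCuspScaling Γ g)
    (F : Set SL(2, ℝ)) (σ : Fin K → ℝ) (H : ℝ) :
    liouville Γ F (hitQuot Γ g (thickRegion σ H 0)) =
      liouville Γ F (hitQuot Γ g (extremeRegion σ H)) := by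
  rw [liouville_apply (measurableSet_hitQuot_thickRegion hg σ H 0),
    liouville_apply (measurableSet_hitQuot_extremeRegion hg σ H), mk_preimage_hitQuot,
    mk_preimage_hitQuot, haar_hitSet_inter_congr (extremeRegion_subset_thickRegion σ H)
      (volume_thickRegion_diff σ H)]

theorem tendsto_liouville_thickRegion [DiscreteTopology Γ] (hg : IsCuspScaling Γ g)
    (F : Set SL(2, ℝ)) [IsFiniteMeasure (liouville Γ F)] (σ : Fin K → ℝ) (H : ℝ) :
    Tendsto (fun n : ℕ => (liouville Γ F).real (hitQuot Γ g (thickRegion σ H (1 / (n + 1)))))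
      atTop (𝓝 ((liouville Γ F).real (hitQuot Γ g (extremeRegion σ H)))) := by
  rw [measureReal_def, ← liouville_hitQuot_thickRegion_zero hg, ← iInter_hitQuot_thickRegion hg]
  refine (ENNReal.tendsto_toReal (measure_ne_top _ _)).comp (tendsto_measure_iInter_atTop
    (fun n => (measurableSet_hitQuot_thickRegion hg σ H _).nullMeasurableSet) ?_
    ⟨0, measure_ne_top _ _⟩)
  intro m n hmn
  refine hitQuot_mono fun κ => thickRegion_mono σ H κ ?_
  have : (m : ℝ) ≤ n := by exact_mod_cast hmn
  gcongr

theorem tendsto_surfaceExtreme [DiscreteTopology Γ] (hneg : (-1 : SL(2, ℝ)) ∈ Γ)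
    (hg : IsCuspScaling Γ g) {F : Set SL(2, ℝ)} [IsFiniteMeasure (liouville Γ F)]
    {lam : Measure (UnitTangent Γ)} [IsProbabilityMeasure lam]
    (hlam : IsAdmissible (liouville Γ F) lam) (σ : Fin K → ℝ) (H : ℝ) :
    Tendsto (fun T : ℝ => lam.real {x₀ | ((H + Real.log T : ℝ) : EReal) <
        ⨆ s ∈ Set.Icc 0 T, relHeightSurface g σ (proj (unstableFlow s x₀))})
      atTop (𝓝 ((liouville Γ F).real (hitQuot Γ g (extremeRegion σ H)))) := by
  have hlog : Tendsto (fun T : ℝ => H + Real.log T) atTop atTop :=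
    tendsto_atTop_add_const_left _ _ Real.tendsto_log_atTop
  have hlow := tendsto_geodesicFlow_hitQuot hg hlam (extremeRegion_bounded σ H)
    (volume_frontier_extremeRegion σ H) (measurableSet_hitQuot_extremeRegion hg σ H) H
  refine tendsto_order.2 ⟨fun b hb => ?_, fun b hb => ?_⟩
  · filter_upwards [hlow.eventually_const_lt hb, eventually_gt_atTop 0,
      hlog.eventually_ge_atTop 0] with T h1 h2 h3
    exact h1.trans_le (measureReal_mono (sectionExtreme_subset_surfaceExtreme hg σ h2 h3))
  -- The thickness is fixed before `T` grows: admissibility applies to one set at a time, and the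
  -- true thickness, of order `e^{-(H + log T)}`, eventually drops below `1 / (n + 1)`.
  · obtain ⟨n, hn⟩ := ((tendsto_liouville_thickRegion hg F σ H).eventually_lt_const hb).exists
    have hup := tendsto_geodesicFlow_hitQuot hg hlam (thickRegion_bounded σ H (1 / (n + 1)))
      (volume_frontier_thickRegion σ H _) (measurableSet_hitQuot_thickRegion hg σ H _) H
    have hsmall : ∀ κ, ∀ᶠ T : ℝ in atTop,
        Real.exp (-(σ κ / 2)) * Real.exp (-(H + Real.log T)) ≤ 1 / (n + 1) := fun κ => by
      have h : Tendsto (fun T : ℝ => Real.exp (-(σ κ / 2)) * Real.exp (-(H + Real.log T))) atTop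
          (𝓝 (Real.exp (-(σ κ / 2)) * 0)) :=
        (Real.tendsto_exp_neg_atTop_nhds_zero.comp hlog).const_mul _
      rw [mul_zero] at h
      exact h.eventually_le_const (by positivity)
    filter_upwards [hup.eventually_lt_const hn, eventually_gt_atTop 0,
      hlog.eventually_ge_atTop 0, eventually_all.2 hsmall] with T h1 h2 h3 h4
    exact (measureReal_mono (surfaceExtreme_subset hneg hg σ h2 h3 h4)).trans_lt h1

theorem tendsto_sectionExtreme [DiscreteTopology Γ]
    (hg : IsCuspScaling Γ g) {F : Set SL(2, ℝ)} [IsFiniteMeasure (liouville Γ F)]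
    {lam : Measure (UnitTangent Γ)}
    (hlam : IsAdmissible (liouville Γ F) lam) (σ : Fin K → ℝ) (H : ℝ) :
    Tendsto (fun T : ℝ => lam.real {x₀ | ((H + Real.log T : ℝ) : EReal) <
        ⨆ ξ ∈ hittingTimes g σ 0 x₀ ∩ Set.Icc 0 T, relHeight g σ (unstableFlow ξ x₀)})
      atTop (𝓝 ((liouville Γ F).real (hitQuot Γ g (extremeRegion σ H)))) := by
  have hlog : Tendsto (fun T : ℝ => H + Real.log T) atTop atTop :=
    tendsto_atTop_add_const_left _ _ Real.tendsto_log_atTop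
  refine (tendsto_geodesicFlow_hitQuot hg hlam (extremeRegion_bounded σ H)
    (volume_frontier_extremeRegion σ H) (measurableSet_hitQuot_extremeRegion hg σ H) H).congr' ?_
  filter_upwards [eventually_gt_atTop 0, hlog.eventually_ge_atTop 0] with T h2 h3
  rw [sectionExtreme_eq hg σ h2 h3]

theorem isProbabilityMeasure_liouville [DiscreteTopology Γ] {F : Set SL(2, ℝ)}
    (hF : IsFundamentalDomain Γ F Measure.haar) (hFfin : Measure.haar F ≠ ∞) :
    IsProbabilityMeasure (liouville Γ F) := by
  refine ⟨?_⟩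
  rw [liouville_apply MeasurableSet.univ, Set.preimage_univ, Set.univ_inter,
    ENNReal.inv_mul_cancel (haar_fundamentalDomain_ne_zero hF) hFfin]

end

end HorocycleExtremes

end

theorem mainTheorem2
    (Γ : Subgroup SL(2, ℝ)) [DiscreteTopology Γ] (hneg : (-1 : SL(2, ℝ)) ∈ Γ)
    (F : Set SL(2, ℝ)) (hF : IsFundamentalDomain Γ F Measure.haar)
    (hFfin : Measure.haar F ≠ ∞)
    (K : ℕ) (hK : 0 < K) (g : Fin K → SL(2, ℝ)) (hg : HorocycleExtremes.IsCuspScaling Γ g)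
    (lam : Measure (HorocycleExtremes.UnitTangent Γ)) [IsProbabilityMeasure lam]
    (hlam : HorocycleExtremes.IsAdmissible (HorocycleExtremes.liouville Γ F) lam)
    (σ : Fin K → ℝ) :
    (Integrable (HorocycleExtremes.extremeDensity Γ g σ) ∧
      (∀ s, 0 ≤ HorocycleExtremes.extremeDensity Γ g σ s) ∧
      ∫ s, HorocycleExtremes.extremeDensity Γ g σ s = 1) ∧
    ∀ H : ℝ,
      Tendsto (fun T : ℝ => lam.real {x₀ | ((H + Real.log T : ℝ) : EReal) <
          ⨆ s ∈ Set.Icc 0 T, HorocycleExtremes.relHeightSurface g σ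
            (HorocycleExtremes.proj (HorocycleExtremes.unstableFlow s x₀))})
        atTop (𝓝 (∫ s in Set.Ioi H, HorocycleExtremes.extremeDensity Γ g σ s)) ∧
      Tendsto (fun T : ℝ => lam.real {x₀ | ((H + Real.log T : ℝ) : EReal) <
          ⨆ ξ ∈ HorocycleExtremes.hittingTimes g σ 0 x₀ ∩ Set.Icc 0 T,
            HorocycleExtremes.relHeight g σ (HorocycleExtremes.unstableFlow ξ x₀)})
        atTop (𝓝 (∫ s in Set.Ioi H, HorocycleExtremes.extremeDensity Γ g σ s)) := by
  open HorocycleExtremes in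
  have hprob := isProbabilityMeasure_liouville hF hFfin
  obtain ⟨c, hc0, hct, hFmean, hFback, hFext⟩ :=
    haar_eq_sectionIntegral hneg hF hFfin hK hg σ
  have hF0 := haar_fundamentalDomain_ne_zero hF
  have hmean0 : meanReturnTime Γ g σ ≠ 0 := fun h => hF0 (by rw [hFmean, h, mul_zero])
  have hmeanT : meanReturnTime Γ g σ ≠ ∞ := fun h =>
    hFfin (by rw [hFmean, h, ENNReal.mul_top hc0])
  have hmeas := measurable_extremeDensity (Γ := Γ) (g := g) hmean0
  have htotal : ∫⁻ s, ENNReal.ofReal (extremeDensity Γ g σ s) = 1 := by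
    rw [← setLIntegral_univ, lintegral_extremeDensity hmean0 MeasurableSet.univ image_exp_neg_univ]
    simp only [le_top, min_eq_right]
    -- The density is normalised by the forward mean but integrates to the backward one; both equal
    -- the covolume divided by `c`.
    have heq : meanReturnTime Γ g σ = sectionIntegral σ (backwardReturnTime Γ g σ) :=
      (ENNReal.mul_right_inj hc0 hct).1 (hFmean.symm.trans hFback)
    rw [← heq, ENNReal.inv_mul_cancel hmean0 hmeanT]
  have hval : ∀ H : ℝ, (liouville Γ F).real (hitQuot Γ g (extremeRegion σ H)) =
      ∫ s in Set.Ioi H, extremeDensity Γ g σ s := by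
    intro H
    -- Dividing by the Haar measure of `F`, which is `c` times the mean return time, cancels the
    -- unknown constant `c`.
    rw [integral_eq_lintegral_of_nonneg_ae (ae_of_all _ fun s => extremeDensity_nonneg s)
      hmeas.aestronglyMeasurable,
      lintegral_extremeDensity hmean0 measurableSet_Ioi (image_exp_neg_Ioi H), measureReal_def,
      liouville_apply (measurableSet_hitQuot_extremeRegion hg σ H), mk_preimage_hitQuot, hFext H,
      hFmean, ENNReal.mul_inv (Or.inl hc0) (Or.inl hct), mul_comm c⁻¹, mul_assoc,
      ← mul_assoc c⁻¹, ENNReal.inv_mul_cancel hc0 hct, one_mul]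
  refine ⟨⟨⟨hmeas.aestronglyMeasurable, ?_⟩, fun s => extremeDensity_nonneg s, ?_⟩, fun H => ?_⟩
  · rw [hasFiniteIntegral_iff_ofReal (ae_of_all _ fun s => extremeDensity_nonneg s), htotal]
    exact ENNReal.one_lt_top
  · rw [integral_eq_lintegral_of_nonneg_ae (ae_of_all _ fun s => extremeDensity_nonneg s)
      hmeas.aestronglyMeasurable, htotal, ENNReal.toReal_one]
  · rw [← hval H]
    exact ⟨tendsto_surfaceExtreme hneg hg hlam σ H, tendsto_sectionExtreme hg hlam σ H⟩
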